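/- Let $g:\mathbb R^d\to\mathbb R^m$ be continuous, injective and differentiable almost everywhere (c.i.d.a.e.), with Jacobian $J_z$ of full column rank for almost every $z$ and $z\mapsto J_z$ locally integrable (so that the length coordinates below exist). Let the prior factorise, $p(z)=\prod_{i=1}^d p_i(z_i)$, with probability densities $p_i$ on $\mathbb R$ such that, up to null sets, $\{p_i>0\}$ is an open interval $I_i$ (e.g. $I_i=\mathbb R$ for a standard Gaussian), and let $B=\prod_i I_i$. "Almost every" below is with respect to the prior, i.e. to Lebesgue measure on $B$. The *manifold density* $p_\mu$ is the density of the push-forward of the prior under $g$ with respect to $d$-dimensional volume (Hausdorff measure) on $\mathcal M_g=\{g(z)\}$. For a base point $b\in B$ let $$u_i(z)=u_i^b(z)=\int_{b_i}^{z_i}\Big\|\frac{\partial g}{\partial z_i}(z_1,\dots,z_{i-1},t,z_{i+1},\dots,z_d)\Big\|\,dt$$ be the coordinate of $g(z)$ along the image of the $i$-th axis-aligned line through $z$. *Disentanglement (D1).* $p_\mu$ is disentangled if for every base point $b\in B$ there are 1-D densities $f_i=f_{i,z}$, where $f_{i,z}$ depends on $z$ only through the $i$-th axis-aligned line through $z$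 and $(z,u)\mapsto f_{i,z}(u)$ is measurable, such that for almost every $z$ (a) for each $i$, $f_{i,z}$ is the density of the push-forward of $p_i$ under $t\mapsto u_i(z_1,\dots,z_{i-1},t,z_{i+1},\dots,z_d)$, and (b) $p_\mu(g(z))=\prod_{i=1}^d f_{i,z}(u_i(z))$; and (c) the random variables $u_1(z),\dots,u_d(z)$ are mutually independent under $z\sim p$. *Constraints.* There is $s=(s_1,\dots,s_d)$ such that **C1:** for almost every $z$, $J_z$ has a singular value decomposition $J_z=U_zS_zV_z^\top$ with $U_z^\top U_z=I$, $S_z=\operatorname{diag}(s_1(z),\dots,s_d(z))$, $s_i(z)\ge 0$, and $V_z=I$ (the right singular vectors are the standard basis, and the singular values are labelled by the latent axes); **C2:** for all $i\neq j$, $s_i$ is locally integrable on $B$ and $\partial s_i/\partial z_j=0$ on $B$ in the weak (distributional) sense. **Theorem (Disentanglement $\Leftrightarrow$ C1–C2).** The density $p_\mu$ exists, and $p_\mu$ is disentangled if and only if $g$ satisfies C1 and C2. If moreover $g$ is $C^2$, the same equivalence holds with C2 read classically: for almost every $z$, the partial derivatives $\partial s_i/\partial z_j(z)$, $i\ne j$,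 exist and vanish. -/

import Mathlib

open MeasureTheory ProbabilityTheory
open scoped ENNReal Matrix ContDiff

noncomputable section

namespace Disentanglement

/-- `g` is continuous, injective and differentiable almost everywhere. -/
structure IsCIDAE {d m : ℕ} (g : EuclideanSpace ℝ (Fin d) → EuclideanSpace ℝ (Fin m)) : Prop where
  continuous : Continuous g
  injective : Function.Injective g
  ae_differentiableAt : ∀ᵐ z, DifferentiableAt ℝ g z

/-- The `i`-th standard basis vector of the latent space. -/
def axis {d : ℕ} (i : Fin d) : EuclideanSpace ℝ (Fin d) := EuclideanSpace.single i 1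

/-- The Jacobian matrix `[J_z]_{k i} = ∂g_k / ∂z_i` at `z`. -/
def jacobian {d m : ℕ} (g : EuclideanSpace ℝ (Fin d) → EuclideanSpace ℝ (Fin m))
    (z : EuclideanSpace ℝ (Fin d)) : Matrix (Fin m) (Fin d) ℝ :=
  Matrix.of fun k i => fderiv ℝ g z (axis i) k

/-- `J = U * diag s * Vᵀ` is a (thin) singular value decomposition. -/
structure IsSVD {d m : ℕ} (J : Matrix (Fin m) (Fin d) ℝ) (U : Matrix (Fin m) (Fin d) ℝ)
    (s : Fin d → ℝ) (V : Matrix (Fin d) (Fin d) ℝ) : Prop where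
  left_orthonormal : Uᵀ * U = 1
  right_orthonormal : Vᵀ * V = 1
  right_orthonormal' : V * Vᵀ = 1
  nonneg : ∀ i, 0 ≤ s i
  eq : J = U * Matrix.diagonal s * Vᵀ

/-- The law on `ℝ` with density `q`. -/
def marginal (q : ℝ → ℝ) : Measure ℝ :=
  volume.withDensity fun t => ENNReal.ofReal (q t)

/-- The factorised prior, with density `p(z) = ∏ i, p i (z i)` on the latent space. -/
def prior {d : ℕ} (p : Fin d → ℝ → ℝ) : Measure (EuclideanSpace ℝ (Fin d)) :=
  volume.withDensity fun z => ENNReal.ofReal (∏ i, p i (z i))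

/-- The box `∏ i, I i` in the latent space. -/
def box {d : ℕ} (I : Fin d → Set ℝ) : Set (EuclideanSpace ℝ (Fin d)) := {z | ∀ i, z i ∈ I i}

/-- `ρ` is a density of the push-forward of the prior under `g`, with respect to the
`d`-dimensional volume (Hausdorff measure normalised as in Euclidean geometry) on the manifold
`{g z}`. -/
structure IsManifoldDensity {d m : ℕ} (g : EuclideanSpace ℝ (Fin d) → EuclideanSpace ℝ (Fin m))
    (p : Fin d → ℝ → ℝ) (ρ : EuclideanSpace ℝ (Fin m) → ℝ≥0∞) : Prop where
  measurable : Measurable ρ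
  map_eq : (prior p).map g =
    ((Measure.euclideanHausdorffMeasure d).restrict (Set.range g)).withDensity ρ

/-- The point of the `i`-th axis-aligned line through `z` whose `i`-th coordinate is `t`. -/
def move {d : ℕ} (z : EuclideanSpace ℝ (Fin d)) (i : Fin d) (t : ℝ) :
    EuclideanSpace ℝ (Fin d) :=
  WithLp.toLp 2 (Function.update (WithLp.ofLp z) i t)

/-- The coordinate `u_i(z)` of `g z` along the image under `g` of the `i`-th axis-aligned line
through `z`: signed length of that image, measured from the point of the line whose `i`-th
coordinate is that of the base point `b`. -/
def coord {d m : ℕ} (g : EuclideanSpace ℝ (Fin d) → EuclideanSpace ℝ (Fin m))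
    (b : EuclideanSpace ℝ (Fin d)) (i : Fin d) (z : EuclideanSpace ℝ (Fin d)) : ℝ :=
  ∫ t in (b i)..(z i), ‖fderiv ℝ g (move z i t) (axis i)‖

/-- The manifold density `ρ` is disentangled. For every base point `b`, from which the coordinates
`u_i` are measured, there are 1-D densities (`f i z` belongs to the `i`-th axis-aligned line through
`z`) that are the push-forwards of the `p i` along the axis-aligned lines and factorise `ρ`, and
the random variables `u_i(z)` are mutually independent under the prior. -/
def IsDisentangled {d m : ℕ} (g : EuclideanSpace ℝ (Fin d) → EuclideanSpace ℝ (Fin m))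
    (p : Fin d → ℝ → ℝ) (I : Fin d → Set ℝ) (ρ : EuclideanSpace ℝ (Fin m) → ℝ≥0∞) : Prop :=
  ∀ b ∈ box I, ∃ f : Fin d → EuclideanSpace ℝ (Fin d) → ℝ → ℝ≥0∞,
    (∀ i, Measurable (Function.uncurry (f i))) ∧
    (∀ i z t, f i (move z i t) = f i z) ∧
    (∀ i, ∀ᵐ z ∂(prior p),
      (marginal (p i)).map (fun t => coord g b i (move z i t)) = volume.withDensity (f i z)) ∧
    (∀ᵐ z ∂(prior p), ρ (g z) = ∏ i, f i z (coord g b i z)) ∧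
    iIndepFun (fun i z => coord g b i z) (prior p)

/-- C1, almost everywhere: the Jacobian has a singular value decomposition whose right singular
vectors are the standard basis vectors. The singular values `s z i` are labelled by the latent
axes. -/
def C1 {d m : ℕ} (g : EuclideanSpace ℝ (Fin d) → EuclideanSpace ℝ (Fin m))
    (p : Fin d → ℝ → ℝ) (s : EuclideanSpace ℝ (Fin d) → Fin d → ℝ) : Prop :=
  ∀ᵐ z ∂(prior p), ∃ U, IsSVD (jacobian g z) U (s z) 1

/-- On the open set `Ω`, `v` is the weak (distributional) partial derivative of `u` in the `j`-th
coordinate. -/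
def HasWeakPartialDeriv {d : ℕ} (Ω : Set (EuclideanSpace ℝ (Fin d)))
    (u v : EuclideanSpace ℝ (Fin d) → ℝ) (j : Fin d) : Prop :=
  LocallyIntegrableOn u Ω ∧ LocallyIntegrableOn v Ω ∧
    ∀ φ : EuclideanSpace ℝ (Fin d) → ℝ, ContDiff ℝ ∞ φ → HasCompactSupport φ → tsupport φ ⊆ Ω →
      ∫ z, u z * fderiv ℝ φ z (axis j) = -∫ z, v z * φ z

/-- C2 for singular values that are defined almost everywhere only: on the box `∏ i, I i`, the
weak partial derivatives `∂s_i/∂z_j`, `i ≠ j`, vanish. -/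
def C2 {d : ℕ} (I : Fin d → Set ℝ) (s : EuclideanSpace ℝ (Fin d) → Fin d → ℝ) : Prop :=
  ∀ i j, i ≠ j → HasWeakPartialDeriv (box I) (fun z => s z i) 0 j

/-- C2, classically: at almost every point the partial derivatives `∂s_i/∂z_j`, `i ≠ j`, exist
and vanish. -/
def C2Classical {d : ℕ} (p : Fin d → ℝ → ℝ) (s : EuclideanSpace ℝ (Fin d) → Fin d → ℝ) : Prop :=
  ∀ᵐ z ∂(prior p), ∀ i j, i ≠ j → HasLineDerivAt ℝ (fun w => s w i) 0 z (axis j)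

end Disentanglement

end

/-!
Let `J = D g z`, let `|J| = √det(JᵀJ)` be its volume factor and `σ_i = ‖J e_i‖` the speed of `g`
along the `i`-th axis.

*The manifold density.* The area formula for injective maps that are differentiable almost
everywhere with injective derivative (`euclideanHausdorffMeasure_image_eq_lintegral`) says that the
`d`-dimensional volume of `g '' s` is `∫ |J|` over `s`. It is proved by cutting the domain into
countably many pieces on which `g` is bilipschitz with constants arbitrarily close to one relative
to a fixed linear map; no Lipschitz bound on `g` is needed, since only points of differentiability
matter. The exceptional null set may have an image of positive volume, but the push-forward of the
prior does not charge this image, so that `ρ (g z) |J| = ∏ p_i(z_i)` for almost every `z`.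

*Orthogonal columns.* Along an axis-aligned line, `u_i` is an increasing function with derivative
`σ_i`, whence the density of the law of `u_i` on that line satisfies `f_i(u_i) σ_i = p_i(z_i)`.
So the factorisation `ρ (g z) = ∏ f_i(u_i)` is `|J| = ∏ σ_i`. This is the equality case of
Hadamard's inequality: the columns of `J` are orthogonal, which in turn is C1, with `s_i = σ_i`.

*Independence.* Both C2 and the independence of the `u_i` mean that `σ_i` is, almost everywhere, a
function of `z_i` alone (`SpeedsSplit`). If it is, so is `u_i`, and functions of independent
variables are independent. Conversely (`speedsSplit_of_iIndepFun`), the event `u_j ≥ 0` is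
`z_j ≥ b_j`. Since the base point is arbitrary, `u_i` is then independent of the `z_j`, `j ≠ i`, so
the law of `u_i` on an `i`-th line is the same for almost all such lines. An increasing function on
an interval is determined by the law it gives to a distribution charging all subintervals, so `u_i`
itself does not depend on the line, and neither does its derivative `σ_i`.

*Weak and classical derivatives.* A locally integrable function whose weak derivatives in the
directions `j ≠ i` vanish has mollifications that depend on `z_i` alone; let the mollification
parameter tend to zero (`exists_conull_eq_of_weak_partial_eq_zero`). In the `C²` case, C1 determines
`s_i` only almost everywhere, so its classical derivatives are first transferred to the continuously
differentiable function `σ_i²`, which agrees with `s_i²` almost everywhere on almost every line.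
-/

/-! ### The area formula for injective maps of full rank -/

section AreaFormula

open Set Filter Topology Module
open scoped NNReal

variable {d : ℕ} {F : Type*} [NormedAddCommGroup F] [InnerProductSpace ℝ F]

/-- A map on `s` with `c⁻¹ ‖L (x - y)‖ ≤ ‖g x - g y‖ ≤ c ‖L (x - y)‖` scales the `d`-dimensional
volume of `s` as the linear map `L` does, up to a factor `c ^ d`. -/
theorem euclideanHausdorffMeasure_image_le_of_bilipschitz [MeasurableSpace F] [BorelSpace F]
    {g : EuclideanSpace ℝ (Fin d) → F} {L : EuclideanSpace ℝ (Fin d) →L[ℝ] F}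
    {s : Set (EuclideanSpace ℝ (Fin d))} {c : ℝ≥0} (hL : Function.Injective L)
    (h1 : ∀ x ∈ s, ∀ y ∈ s, ‖L (x - y)‖ ≤ c * ‖g x - g y‖)
    (h2 : ∀ x ∈ s, ∀ y ∈ s, ‖g x - g y‖ ≤ c * ‖L (x - y)‖) :
    (Measure.euclideanHausdorffMeasure d : Measure F) (g '' s) ≤
        (c : ℝ≥0∞) ^ d * (ENNReal.ofReal (LinearMap.normDet L.toLinearMap) * volume s) ∧
      ENNReal.ofReal (LinearMap.normDet L.toLinearMap) * volume s ≤
        (c : ℝ≥0∞) ^ d * (Measure.euclideanHausdorffMeasure d : Measure F) (g '' s) := by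
  -- If `b` increases distances at most by the factor `c` compared with `a`, then `b ∘ a⁻¹` is
  -- `c`-Lipschitz.
  have key : ∀ (A : Set (EuclideanSpace ℝ (Fin d))) (a b : EuclideanSpace ℝ (Fin d) → F),
      InjOn a A → (∀ x ∈ A, ∀ y ∈ A, ‖b x - b y‖ ≤ c * ‖a x - a y‖) →
      (Measure.euclideanHausdorffMeasure d : Measure F) (b '' A) ≤
        (c : ℝ≥0∞) ^ d * (Measure.euclideanHausdorffMeasure d : Measure F) (a '' A) := by
    intro A a b ha hab
    have hlip : LipschitzOnWith c (b ∘ Function.invFunOn a A) (a '' A) := by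
      refine LipschitzOnWith.of_dist_le_mul ?_
      rintro _ ⟨x, hx, rfl⟩ _ ⟨y, hy, rfl⟩
      simp only [Function.comp, ha.leftInvOn_invFunOn hx, ha.leftInvOn_invFunOn hy, dist_eq_norm]
      exact hab x hx y hy
    have him : (b ∘ Function.invFunOn a A) '' (a '' A) = b '' A := by
      rw [image_image]
      exact image_congr fun x hx => by simp [ha.leftInvOn_invFunOn hx]
    have := hlip.hausdorffMeasure_image_le (d := (d : ℝ)) (by positivity)
    rw [him, ENNReal.rpow_natCast] at this
    simp only [Measure.euclideanHausdorffMeasure_def, Measure.smul_apply]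
    rw [ENNReal.smul_def, ENNReal.smul_def, smul_eq_mul, smul_eq_mul, mul_left_comm]
    gcongr
  have hvol : ENNReal.ofReal (LinearMap.normDet L.toLinearMap) * volume s =
      (Measure.euclideanHausdorffMeasure d : Measure F) (L '' s) := by
    have := LinearMap.euclideanHausdorffMeasure_image L.toLinearMap s
    rw [InnerProductSpace.euclideanHausdorffMeasure_eq_volume, finrank_euclideanSpace_fin] at this
    exact this.symm
  have hg : InjOn g s := by
    intro x hx y hy hxy
    have := h1 x hx y hy
    rw [hxy, sub_self, norm_zero, mul_zero, norm_le_zero_iff] at this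
    exact sub_eq_zero.1 (hL (this.trans (map_zero L).symm))
  rw [hvol]
  exact ⟨key s L g hL.injOn fun x hx y hy => by simpa using h2 x hx y hy,
    key s g L hg fun x hx y hy => by simpa using h1 x hx y hy⟩

/-- Vectors `w` sufficiently close to `L v`, relative to `‖v‖`, have norm comparable to that of
`L v` up to a given factor `c > 1`, because an injective linear map `L` is bounded below. -/
theorem exists_delta_comparable [FiniteDimensional ℝ F]
    {L : EuclideanSpace ℝ (Fin d) →L[ℝ] F} {c : ℝ≥0} (hc : 1 < c) (hL : Function.Injective L) :
    ∃ δ : ℝ≥0, 0 < δ ∧ ∀ v w, ‖w - L v‖ ≤ δ * ‖v‖ → ‖L v‖ ≤ c * ‖w‖ ∧ ‖w‖ ≤ c * ‖L v‖ := by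
  obtain ⟨K, hK, hanti⟩ := L.toLinearMap.exists_antilipschitzWith (LinearMap.ker_eq_bot.2 hL)
  have hanti' : ∀ v, ‖v‖ ≤ K * ‖L v‖ := fun v => by
    simpa using hanti.le_mul_dist v 0
  have hc0 : (0 : ℝ) < c := lt_trans one_pos (by exact_mod_cast hc)
  have hc1 : (1 : ℝ) < c := by exact_mod_cast hc
  have hK' : (0 : ℝ) < K := by exact_mod_cast hK
  refine ⟨⟨(1 - (c : ℝ)⁻¹) / K, div_nonneg (sub_nonneg.2 (inv_le_one_of_one_le₀ hc1.le)) hK'.le⟩,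
    ?_, ?_⟩
  · exact div_pos (sub_pos.2 (inv_lt_one_of_one_lt₀ hc1)) hK'
  · intro v w h
    change ‖w - L v‖ ≤ (1 - (c : ℝ)⁻¹) / K * ‖v‖ at h
    have h' : ‖w - L v‖ ≤ (1 - (c : ℝ)⁻¹) * ‖L v‖ := by
      refine h.trans ?_
      have : 0 ≤ (1 - (c : ℝ)⁻¹) / K :=
        div_nonneg (sub_nonneg.2 (inv_le_one_of_one_le₀ hc1.le)) hK'.le
      calc (1 - (c : ℝ)⁻¹) / K * ‖v‖ ≤ (1 - (c : ℝ)⁻¹) / K * (K * ‖L v‖) := by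
            gcongr; exact hanti' v
        _ = (1 - (c : ℝ)⁻¹) * ‖L v‖ := by field_simp
    have e1 : ‖L v‖ ≤ ‖w‖ + ‖w - L v‖ := by
      have := norm_sub_le w (w - L v); simpa using this
    have e2 : ‖w‖ ≤ ‖L v‖ + ‖w - L v‖ := by
      have := norm_add_le (L v) (w - L v); simpa using this
    constructor
    · have : (c : ℝ)⁻¹ * ‖L v‖ ≤ ‖w‖ := by linarith
      rwa [inv_mul_le_iff₀ hc0] at this
    · have : 2 - (c : ℝ)⁻¹ ≤ c := by
        have : (c : ℝ) * (c : ℝ)⁻¹ = 1 := mul_inv_cancel₀ hc0.ne'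
        have hp : 0 < (c : ℝ)⁻¹ := inv_pos.2 hc0
        nlinarith [sq_nonneg ((c : ℝ) - 1)]
      nlinarith [norm_nonneg (L v)]

/-- Up to a factor `c`, the domain of a map with injective derivatives splits into countably many
measurable pieces on which the increments of the map, and its derivatives, are those of a fixed
injective linear map. -/
theorem exists_partition_comparable [FiniteDimensional ℝ F]
    {g : EuclideanSpace ℝ (Fin d) → F}
    {g' : EuclideanSpace ℝ (Fin d) → EuclideanSpace ℝ (Fin d) →L[ℝ] F}
    {s : Set (EuclideanSpace ℝ (Fin d))} (hs : MeasurableSet s) (hg' : Measurable g')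
    (hd : ∀ x ∈ s, HasFDerivAt g (g' x) x) (hinj : ∀ x ∈ s, Function.Injective (g' x))
    {c : ℝ≥0} (hc : 1 < c) :
    ∃ t : ℕ → Set (EuclideanSpace ℝ (Fin d)), Pairwise (Function.onFun Disjoint t) ∧
      (∀ n, MeasurableSet (t n)) ∧ (⋃ n, t n) = s ∧
      ∀ n, (t n).Nonempty → ∃ L : EuclideanSpace ℝ (Fin d) →L[ℝ] F, Function.Injective L ∧
        (∀ x ∈ t n, ∀ y ∈ t n, ‖L (x - y)‖ ≤ c * ‖g x - g y‖ ∧ ‖g x - g y‖ ≤ c * ‖L (x - y)‖) ∧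
        ∀ x ∈ t n, ∀ v, ‖L v‖ ≤ c * ‖g' x v‖ ∧ ‖g' x v‖ ≤ c * ‖L v‖ := by
  rcases s.eq_empty_or_nonempty with rfl | ⟨x₀, hx₀⟩
  · exact ⟨fun _ => ∅, fun _ _ _ => by simp [Function.onFun], fun _ => .empty, by simp, by simp⟩
  have hδ : ∀ A : {A : EuclideanSpace ℝ (Fin d) →L[ℝ] F // Function.Injective A}, ∃ δ : ℝ≥0, 0 < δ ∧
      ∀ v w, ‖w - A.1 v‖ ≤ δ * ‖v‖ → ‖A.1 v‖ ≤ c * ‖w‖ ∧ ‖w‖ ≤ c * ‖A.1 v‖ :=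
    fun A => exists_delta_comparable hc A.2
  choose δ δpos hδ using hδ
  obtain ⟨T, hTc, hT⟩ := TopologicalSpace.isOpen_iUnion_countable
    (fun A : {A : EuclideanSpace ℝ (Fin d) →L[ℝ] F // Function.Injective A} =>
      Metric.ball A.1 (δ A / 2 : ℝ)) (fun _ => Metric.isOpen_ball)
  have hcov : ∀ x ∈ s, ∃ A ∈ T, g' x ∈ Metric.ball A.1 (δ A / 2 : ℝ) := by
    intro x hx
    have : g' x ∈ ⋃ A : {A : EuclideanSpace ℝ (Fin d) →L[ℝ] F // Function.Injective A},
        Metric.ball A.1 (δ A / 2 : ℝ) :=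
      mem_iUnion.2 ⟨⟨g' x, hinj x hx⟩, Metric.mem_ball_self (half_pos (δpos _))⟩
    rw [← hT] at this
    simpa using this
  -- The pieces of `s` on which the derivative lies in a given ball are split further.
  have hpart : ∀ A : {A : EuclideanSpace ℝ (Fin d) →L[ℝ] F // Function.Injective A},
      ∃ t : ℕ → Set (EuclideanSpace ℝ (Fin d)), (∀ n, MeasurableSet (t n)) ∧
        s ∩ g' ⁻¹' Metric.ball A.1 (δ A / 2 : ℝ) ⊆ ⋃ n, t n ∧
        ∀ n, ∀ x ∈ s ∩ g' ⁻¹' Metric.ball A.1 (δ A / 2 : ℝ) ∩ t n,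
          ∀ y ∈ s ∩ g' ⁻¹' Metric.ball A.1 (δ A / 2 : ℝ) ∩ t n,
          ‖g x - g y - A.1 (x - y)‖ ≤ δ A * ‖x - y‖ := by
    intro A
    obtain ⟨t, B, -, ht, hcov, happ, hB⟩ :=
      exists_partition_approximatesLinearOn_of_hasFDerivWithinAt g
        (s ∩ g' ⁻¹' Metric.ball A.1 (δ A / 2 : ℝ)) g'
        (fun x hx => (hd x hx.1).hasFDerivWithinAt) (fun _ => δ A / 2)
        (fun _ => (half_pos (δpos A)).ne')
    refine ⟨t, ht, hcov, fun n x hx y hy => ?_⟩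
    obtain ⟨z, hz, hBz⟩ := hB ⟨x, hx.1⟩ n
    have h1 := happ n x hx y hy
    have h2 : ‖(B n - A.1) (x - y)‖ ≤ (δ A / 2 : ℝ) * ‖x - y‖ := by
      refine (ContinuousLinearMap.le_opNorm _ _).trans ?_
      gcongr
      have := hz.2
      rw [mem_preimage, mem_ball_iff_norm, ← hBz] at this
      exact this.le
    have h3 : g x - g y - A.1 (x - y) = (g x - g y - B n (x - y)) + (B n - A.1) (x - y) := by
      simp
    rw [h3]
    refine (norm_add_le _ _).trans ?_
    simp only [NNReal.coe_div, NNReal.coe_ofNat] at h1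
    linarith
  choose t ht htcov happ using hpart
  obtain ⟨A₀, hA₀, -⟩ := hcov x₀ hx₀
  have : Countable T := hTc.to_subtype
  have : Nonempty (T × ℕ) := ⟨⟨⟨A₀, hA₀⟩, 0⟩⟩
  obtain ⟨e, he⟩ := exists_surjective_nat (T × ℕ)
  let u : ℕ → Set (EuclideanSpace ℝ (Fin d)) := fun n =>
    s ∩ g' ⁻¹' Metric.ball (e n).1.1.1 (δ (e n).1.1 / 2 : ℝ) ∩ t (e n).1.1 (e n).2
  have hu : ∀ n, MeasurableSet (u n) := fun n =>
    (hs.inter (hg' Metric.isOpen_ball.measurableSet)).inter (ht _ _)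
  refine ⟨disjointed u, disjoint_disjointed u, fun n => MeasurableSet.disjointed hu n, ?_, ?_⟩
  · rw [iUnion_disjointed]
    refine Subset.antisymm (iUnion_subset fun n x hx => hx.1.1) fun x hx => ?_
    obtain ⟨A, hA, hxA⟩ := hcov x hx
    obtain ⟨k, hk⟩ := mem_iUnion.1 (htcov A ⟨hx, hxA⟩)
    obtain ⟨n, hn⟩ := he ⟨⟨A, hA⟩, k⟩
    refine mem_iUnion.2 ⟨n, ?_⟩
    simp only [u, hn]
    exact ⟨⟨hx, hxA⟩, hk⟩
  · intro n _
    have hsub : disjointed u n ⊆ u n := disjointed_subset u n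
    refine ⟨(e n).1.1.1, (e n).1.1.2, fun x hx y hy => ?_, fun x hx v => ?_⟩
    · exact hδ _ _ _ (happ _ _ x (hsub hx) y (hsub hy))
    · refine hδ _ _ _ ?_
      have := (hsub hx).1.2
      rw [mem_preimage, mem_ball_iff_norm] at this
      refine (ContinuousLinearMap.le_opNorm (g' x - (e n).1.1.1) v).trans ?_
      gcongr
      exact this.le.trans (half_le_self (NNReal.coe_nonneg _))

/-- Comparable linear maps have comparable volume factors. -/
theorem normDet_le_of_comparable [MeasurableSpace F] [BorelSpace F]
    {L L' : EuclideanSpace ℝ (Fin d) →L[ℝ] F} {c : ℝ≥0} (hL : Function.Injective L)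
    (h : ∀ v, ‖L v‖ ≤ c * ‖L' v‖ ∧ ‖L' v‖ ≤ c * ‖L v‖) :
    ENNReal.ofReal (LinearMap.normDet L'.toLinearMap) ≤
        (c : ℝ≥0∞) ^ d * ENNReal.ofReal (LinearMap.normDet L.toLinearMap) ∧
      ENNReal.ofReal (LinearMap.normDet L.toLinearMap) ≤
        (c : ℝ≥0∞) ^ d * ENNReal.ofReal (LinearMap.normDet L'.toLinearMap) := by
  have h1 := euclideanHausdorffMeasure_image_le_of_bilipschitz (g := L') (c := c)
    (s := Metric.ball 0 1) hL (fun x _ y _ => by simpa using (h (x - y)).1)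
    (fun x _ y _ => by simpa using (h (x - y)).2)
  have h2 : (Measure.euclideanHausdorffMeasure d : Measure F)
      (L' '' Metric.ball (0 : EuclideanSpace ℝ (Fin d)) 1) =
      ENNReal.ofReal (LinearMap.normDet L'.toLinearMap) *
        volume (Metric.ball (0 : EuclideanSpace ℝ (Fin d)) 1) := by
    have := LinearMap.euclideanHausdorffMeasure_image L'.toLinearMap
      (Metric.ball (0 : EuclideanSpace ℝ (Fin d)) 1)
    rwa [InnerProductSpace.euclideanHausdorffMeasure_eq_volume, finrank_euclideanSpace_fin] at this
  have h0 : volume (Metric.ball (0 : EuclideanSpace ℝ (Fin d)) 1) ≠ 0 :=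
    (Metric.measure_ball_pos volume 0 one_pos).ne'
  have htop : volume (Metric.ball (0 : EuclideanSpace ℝ (Fin d)) 1) ≠ ⊤ := measure_ball_lt_top.ne
  -- Cancel the volume of the unit ball, whose images under `L` and `L'` have been compared.
  rw [h2, ← mul_assoc, ← mul_assoc] at h1
  exact ⟨(ENNReal.mul_le_mul_iff_left h0 htop).1 h1.1, (ENNReal.mul_le_mul_iff_left h0 htop).1 h1.2⟩

theorem ENNReal.le_of_forall_one_lt_le_pow_mul {a b : ℝ≥0∞} {n : ℕ}
    (h : ∀ c : ℝ≥0, 1 < c → a ≤ (c : ℝ≥0∞) ^ n * b) : a ≤ b := by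
  rcases eq_or_ne b 0 with rfl | hb
  · simpa using h 2 (by norm_num)
  have hlim : Tendsto (fun c : ℝ≥0 => (c : ℝ≥0∞) ^ n * b) (𝓝[>] 1) (𝓝 ((1 : ℝ≥0) ^ n * b)) := by
    refine ENNReal.Tendsto.mul_const ?_ (Or.inl (by simp))
    have : Continuous fun c : ℝ≥0 => ((c ^ n : ℝ≥0) : ℝ≥0∞) := by fun_prop
    have := (this.tendsto 1).mono_left (nhdsWithin_le_nhds (s := Ioi 1))
    simpa using this
  have := ge_of_tendsto hlim (eventually_nhdsWithin_of_forall fun c hc => h c hc)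
  simpa using this

/-- The area formula: the `d`-dimensional volume of the image of `s` under a measurable
embedding that has injective derivatives on `s` is the integral over `s` of the volume factor of
the derivative. -/
theorem euclideanHausdorffMeasure_image_eq_lintegral [MeasurableSpace F] [BorelSpace F]
    [FiniteDimensional ℝ F]
    {g : EuclideanSpace ℝ (Fin d) → F}
    {g' : EuclideanSpace ℝ (Fin d) → EuclideanSpace ℝ (Fin d) →L[ℝ] F}
    {s : Set (EuclideanSpace ℝ (Fin d))} (hs : MeasurableSet s) (hg' : Measurable g')
    (hd : ∀ x ∈ s, HasFDerivAt g (g' x) x) (hinj : ∀ x ∈ s, Function.Injective (g' x))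
    (hg : MeasurableEmbedding g) :
    (Measure.euclideanHausdorffMeasure d : Measure F) (g '' s) =
      ∫⁻ x in s, ENNReal.ofReal (LinearMap.normDet (g' x).toLinearMap) := by
  -- On each piece the volume of the image and the integral both cost a factor `c ^ d`.
  have main : ∀ c : ℝ≥0, 1 < c →
      (Measure.euclideanHausdorffMeasure d : Measure F) (g '' s) ≤ (c : ℝ≥0∞) ^ (2 * d) *
        ∫⁻ x in s, ENNReal.ofReal (LinearMap.normDet (g' x).toLinearMap) ∧
      ∫⁻ x in s, ENNReal.ofReal (LinearMap.normDet (g' x).toLinearMap) ≤ (c : ℝ≥0∞) ^ (2 * d) *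
        (Measure.euclideanHausdorffMeasure d : Measure F) (g '' s) := by
    intro c hc
    obtain ⟨t, tdisj, tmeas, tU, ht⟩ := exists_partition_comparable hs hg' hd hinj hc
    have e1 : (Measure.euclideanHausdorffMeasure d : Measure F) (g '' s) =
        ∑' n, (Measure.euclideanHausdorffMeasure d : Measure F) (g '' t n) := by
      rw [← tU, image_iUnion, measure_iUnion]
      · exact fun i j hij => (disjoint_image_iff hg.injective).2 (tdisj hij)
      · exact fun n => hg.measurableSet_image.2 (tmeas n)
    have e2 : ∫⁻ x in s, ENNReal.ofReal (LinearMap.normDet (g' x).toLinearMap) =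
        ∑' n, ∫⁻ x in t n, ENNReal.ofReal (LinearMap.normDet (g' x).toLinearMap) := by
      rw [← tU, lintegral_iUnion tmeas tdisj]
    have hpiece : ∀ n, (Measure.euclideanHausdorffMeasure d : Measure F) (g '' t n) ≤
          (c : ℝ≥0∞) ^ (2 * d) *
            ∫⁻ x in t n, ENNReal.ofReal (LinearMap.normDet (g' x).toLinearMap) ∧
        ∫⁻ x in t n, ENNReal.ofReal (LinearMap.normDet (g' x).toLinearMap) ≤
          (c : ℝ≥0∞) ^ (2 * d) * (Measure.euclideanHausdorffMeasure d : Measure F) (g '' t n) := by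
      intro n
      rcases (t n).eq_empty_or_nonempty with h0 | h0
      · simp [h0]
      obtain ⟨L, hL, h1, h2⟩ := ht n h0
      have hb := euclideanHausdorffMeasure_image_le_of_bilipschitz hL
        (fun x hx y hy => (h1 x hx y hy).1) (fun x hx y hy => (h1 x hx y hy).2)
      have hcfin : (c : ℝ≥0∞) ^ d ≠ ⊤ := ENNReal.pow_ne_top ENNReal.coe_ne_top
      rw [two_mul, pow_add, mul_assoc, mul_assoc]
      constructor
      · refine hb.1.trans ?_
        refine mul_le_mul_right ?_ _
        rw [← lintegral_const_mul' _ _ hcfin, ← setLIntegral_const]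
        exact setLIntegral_mono' (tmeas n) fun x hx => (normDet_le_of_comparable hL (h2 x hx)).2
      · refine le_trans ?_ (mul_le_mul_right hb.2 _)
        rw [← mul_assoc, ← setLIntegral_const]
        exact setLIntegral_mono' (tmeas n) fun x hx => (normDet_le_of_comparable hL (h2 x hx)).1
    rw [e1, e2, ← ENNReal.tsum_mul_left, ← ENNReal.tsum_mul_left]
    exact ⟨ENNReal.tsum_le_tsum fun n => (hpiece n).1, ENNReal.tsum_le_tsum fun n => (hpiece n).2⟩
  exact le_antisymm (ENNReal.le_of_forall_one_lt_le_pow_mul fun c hc => (main c hc).1)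
    (ENNReal.le_of_forall_one_lt_le_pow_mul fun c hc => (main c hc).2)

theorem measurable_normDet {α : Type*} [MeasurableSpace α] [FiniteDimensional ℝ F]
    {g' : α → EuclideanSpace ℝ (Fin d) →L[ℝ] F} (hg' : Measurable g') :
    Measurable fun x => LinearMap.normDet (g' x).toLinearMap := by
  have : (fun x => LinearMap.normDet (g' x).toLinearMap) = fun x =>
      √(Matrix.gram ℝ fun i => g' x (EuclideanSpace.basisFun (Fin d) ℝ i)).det := by
    -- The volume factor is the square root of a Gram determinant.
    funext x
    have := LinearMap.normDet_sq_eq_det_gram (g' x).toLinearMap (EuclideanSpace.basisFun (Fin d) ℝ)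
    simp only [RCLike.ofReal_real_eq_id, id] at this
    rw [← Real.sqrt_sq (LinearMap.normDet_nonneg _), this]
    rfl
  rw [this]
  have hc : Continuous fun L : EuclideanSpace ℝ (Fin d) →L[ℝ] F =>
      √(Matrix.gram ℝ fun i => L (EuclideanSpace.basisFun (Fin d) ℝ i)).det := by
    refine Real.continuous_sqrt.comp (Continuous.matrix_det ?_)
    refine continuous_matrix fun i j => ?_
    simp only [Matrix.gram_apply]
    fun_prop
  exact hc.measurable.comp hg'

end AreaFormula

/-! ### Densities with respect to the volume on the image -/

namespace Disentanglement

section Density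

open Set Filter

variable {d m : ℕ} {g : EuclideanSpace ℝ (Fin d) → EuclideanSpace ℝ (Fin m)}

/-- The volume factor `√det (Jᵀ J)` of `g` at `z`. -/
noncomputable def volumeFactor {d m : ℕ} (g : EuclideanSpace ℝ (Fin d) → EuclideanSpace ℝ (Fin m))
    (z : EuclideanSpace ℝ (Fin d)) : ℝ := LinearMap.normDet (fderiv ℝ g z).toLinearMap

theorem measurable_volumeFactor : Measurable (volumeFactor g) :=
  measurable_normDet (measurable_fderiv ℝ g)

theorem volumeFactor_pos {z : EuclideanSpace ℝ (Fin d)}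
    (hz : Function.Injective (fderiv ℝ g z)) : 0 < volumeFactor g z :=
  (LinearMap.normDet_nonneg _).lt_of_ne'
    (((fderiv ℝ g z).toLinearMap.normDet_ne_zero_tfae.out 4 0).1 hz)

/-- The points at which `g` is differentiable with injective derivative. -/
def regularSet {d m : ℕ} (g : EuclideanSpace ℝ (Fin d) → EuclideanSpace ℝ (Fin m)) :
    Set (EuclideanSpace ℝ (Fin d)) :=
  {z | DifferentiableAt ℝ g z ∧ Function.Injective (fderiv ℝ g z)}

theorem measurableSet_regularSet : MeasurableSet (regularSet g) := by
  have : {z | Function.Injective (fderiv ℝ g z)} = {z | volumeFactor g z ≠ 0} := by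
    ext z
    exact ((fderiv ℝ g z).toLinearMap.normDet_ne_zero_tfae.out 4 0)
  refine (measurableSet_of_differentiableAt ℝ g).inter
    (s₂ := {z | Function.Injective (fderiv ℝ g z)}) ?_
  rw [this]
  exact (measurable_volumeFactor (measurableSet_singleton 0)).compl

theorem ae_mem_regularSet (hg : IsCIDAE g)
    (hrank : ∀ᵐ z, Function.Injective (fderiv ℝ g z)) : ∀ᵐ z, z ∈ regularSet g := by
  filter_upwards [hg.ae_differentiableAt, hrank] with z h1 h2 using ⟨h1, h2⟩

/-- The area formula as an integration formula over images. -/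
theorem setLIntegral_image_regularSet (hg : IsCIDAE g) {C : Set (EuclideanSpace ℝ (Fin d))}
    (hC : MeasurableSet C) (hCD : C ⊆ regularSet g) {ρ : EuclideanSpace ℝ (Fin m) → ℝ≥0∞}
    (hρ : Measurable ρ) :
    ∫⁻ y in g '' C, ρ y ∂(Measure.euclideanHausdorffMeasure d) =
      ∫⁻ z in C, ENNReal.ofReal (volumeFactor g z) * ρ (g z) := by
  have hemb : MeasurableEmbedding g := hg.continuous.measurableEmbedding hg.injective
  have hmap : ((volume.restrict C).withDensity
      fun z => ENNReal.ofReal (volumeFactor g z)).map g =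
        (Measure.euclideanHausdorffMeasure d).restrict (g '' C) := by
    ext A hA
    rw [hemb.map_apply, withDensity_apply _ (hg.continuous.measurable hA),
      Measure.restrict_restrict (hg.continuous.measurable hA), Measure.restrict_apply hA,
      ← image_preimage_inter]
    have hm : MeasurableSet (g ⁻¹' A ∩ C) := (hg.continuous.measurable hA).inter hC
    exact (euclideanHausdorffMeasure_image_eq_lintegral hm (measurable_fderiv ℝ g)
      (fun x hx => (hCD hx.2).1.hasFDerivAt) (fun x hx => (hCD hx.2).2) hemb).symm
  rw [← hmap, hemb.lintegral_map,
    lintegral_withDensity_eq_lintegral_mul _ measurable_volumeFactor.ennreal_ofReal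
      (g := fun z => ρ (g z)) (hρ.comp hg.continuous.measurable)]
  rfl

variable {p : Fin d → ℝ → ℝ}

theorem measurable_priorDensity (hp : ∀ i, Measurable (p i)) :
    Measurable fun z : EuclideanSpace ℝ (Fin d) => ENNReal.ofReal (∏ i, p i (z i)) := by
  refine (Finset.measurable_prod _ fun i _ => (hp i).comp ?_).ennreal_ofReal
  fun_prop

/-- A manifold density is the prior density over the volume factor, transported by `g`. It has to be
put to zero on the image of the exceptional null set, which need not be a null set itself. -/
theorem exists_isManifoldDensity (hg : IsCIDAE g)
    (hrank : ∀ᵐ z, Function.Injective (fderiv ℝ g z)) (hp : ∀ i, Measurable (p i)) :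
    ∃ ρ, IsManifoldDensity g p ρ := by
  classical
  have hemb : MeasurableEmbedding g := hg.continuous.measurableEmbedding hg.injective
  have hq := measurable_priorDensity hp
  have hD := measurableSet_regularSet (g := g)
  have hr : Measurable ((regularSet g).indicator fun z =>
      ENNReal.ofReal (∏ i, p i (z i)) / ENNReal.ofReal (volumeFactor g z)) :=
    (hq.div measurable_volumeFactor.ennreal_ofReal).indicator hD
  obtain ⟨ρ, hρ, hρg⟩ := hemb.exists_measurable_extend hr fun _ => ⟨0⟩
  refine ⟨ρ, hρ, ?_⟩
  ext A hA
  have hgA := hg.continuous.measurable hA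
  rw [hemb.map_apply, prior, withDensity_apply _ hgA, withDensity_apply _ hA,
    Measure.restrict_restrict hA]
  have e1 : g '' (g ⁻¹' A ∩ regularSet g) ⊆ A ∩ range g := by
    rintro _ ⟨z, hz, rfl⟩
    exact ⟨hz.1, z, rfl⟩
  -- Off the image of the regular set `ρ` vanishes.
  have e2 : ∫⁻ y in A ∩ range g, ρ y ∂(Measure.euclideanHausdorffMeasure d) =
      ∫⁻ y in g '' (g ⁻¹' A ∩ regularSet g), ρ y ∂(Measure.euclideanHausdorffMeasure d) := by
    rw [← lintegral_indicator (hA.inter hemb.measurableSet_range),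
      ← lintegral_indicator (hemb.measurableSet_image.2 (hgA.inter hD))]
    congr 1
    funext y
    by_cases hy : y ∈ g '' (g ⁻¹' A ∩ regularSet g)
    · rw [indicator_of_mem hy, indicator_of_mem (e1 hy)]
    · rw [indicator_of_notMem hy]
      refine indicator_apply_eq_zero.2 ?_
      rintro ⟨hyA, z, rfl⟩
      have hz : z ∉ regularSet g := fun hz => hy ⟨z, ⟨hyA, hz⟩, rfl⟩
      have := congrFun hρg z
      rwa [indicator_of_notMem hz] at this
  rw [e2, setLIntegral_image_regularSet hg (hgA.inter hD) inter_subset_right hρ]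
  have e3 : ∫⁻ z in g ⁻¹' A ∩ regularSet g, ENNReal.ofReal (volumeFactor g z) * ρ (g z) =
      ∫⁻ z in g ⁻¹' A ∩ regularSet g, ENNReal.ofReal (∏ i, p i (z i)) := by
    refine setLIntegral_congr_fun (hgA.inter hD) fun z hz => ?_
    have h1 := congrFun hρg z
    rw [indicator_of_mem hz.2] at h1
    simp only [Function.comp] at h1
    have h2 := volumeFactor_pos hz.2.2
    simp only [h1]
    exact ENNReal.mul_div_cancel (by simpa using h2) ENNReal.ofReal_ne_top
  rw [e3]
  refine setLIntegral_congr ?_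
  filter_upwards [ae_mem_regularSet hg hrank] with z hz
  exact propext ⟨fun h => ⟨h, hz⟩, fun h => h.1⟩

/-- Every manifold density is, almost everywhere in the latent space, the prior density over the
volume factor. -/
theorem IsManifoldDensity.volumeFactor_mul (hg : IsCIDAE g)
    (hrank : ∀ᵐ z, Function.Injective (fderiv ℝ g z)) (hp : ∀ i, Measurable (p i))
    {ρ : EuclideanSpace ℝ (Fin m) → ℝ≥0∞} (hρ : IsManifoldDensity g p ρ) :
    ∀ᵐ z, ENNReal.ofReal (volumeFactor g z) * ρ (g z) = ENNReal.ofReal (∏ i, p i (z i)) := by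
  have hemb : MeasurableEmbedding g := hg.continuous.measurableEmbedding hg.injective
  have hq := measurable_priorDensity hp
  have hD := measurableSet_regularSet (g := g)
  have hfull := ae_mem_regularSet hg hrank
  have hm : Measurable fun z => ENNReal.ofReal (volumeFactor g z) * ρ (g z) :=
    measurable_volumeFactor.ennreal_ofReal.mul (hρ.measurable.comp hg.continuous.measurable)
  refine (withDensity_eq_iff_of_sigmaFinite hm.aemeasurable hq.aemeasurable).1 ?_
  ext C hC
  have hCD : (C : Set _) =ᵐ[volume] (C ∩ regularSet g : Set _) := by
    filter_upwards [hfull] with z hz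
    exact propext ⟨fun h => ⟨h, hz⟩, fun h => h.1⟩
  rw [withDensity_apply _ hC, withDensity_apply _ hC, setLIntegral_congr hCD,
    setLIntegral_congr hCD,
    ← setLIntegral_image_regularSet hg (hC.inter hD) inter_subset_right hρ.measurable]
  have himg : MeasurableSet (g '' (C ∩ regularSet g)) := hemb.measurableSet_image.2 (hC.inter hD)
  have := congrArg (fun μ => μ (g '' (C ∩ regularSet g))) hρ.map_eq
  simp only [hemb.map_apply, hg.injective.preimage_image] at this
  rw [prior, withDensity_apply _ (hC.inter hD), withDensity_apply _ himg,
    Measure.restrict_restrict himg, inter_eq_self_of_subset_left (image_subset_range _ _)] at this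
  exact this.symm

end Density
end Disentanglement

/-! ### Hadamard's inequality: the case of equality -/

/-- The case of equality in the inequality between the geometric and the arithmetic mean of the
eigenvalues. -/
theorem Matrix.PosSemidef.eq_one_of_det_of_trace {n : Type*} [Fintype n] [DecidableEq n]
    {A : Matrix n n ℝ} (hA : A.PosSemidef) (hdet : A.det = 1) (htr : A.trace = Fintype.card n) :
    A = 1 := by
  have hH := hA.isHermitian
  have hprod : ∏ i, hH.eigenvalues i = 1 := by
    have := hH.det_eq_prod_eigenvalues
    rw [hdet] at this
    simpa using this.symm
  have hsum : ∑ i, hH.eigenvalues i = Fintype.card n := by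
    have := hH.trace_eq_sum_eigenvalues
    rw [htr] at this
    simpa using this.symm
  have hpos : ∀ i, 0 < hH.eigenvalues i := by
    intro i
    refine (hA.eigenvalues_nonneg i).lt_of_ne' fun h0 => ?_
    rw [Finset.prod_eq_zero (Finset.mem_univ i) h0] at hprod
    exact zero_ne_one hprod
  have hlog : ∑ i, (hH.eigenvalues i - 1 - Real.log (hH.eigenvalues i)) = 0 := by
    rw [Finset.sum_sub_distrib, Finset.sum_sub_distrib, hsum,
      ← Real.log_prod fun i _ => (hpos i).ne', hprod]
    simp
  have hone : ∀ i, hH.eigenvalues i = 1 := by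
    intro i
    have h0 : ∀ i ∈ Finset.univ, 0 ≤ hH.eigenvalues i - 1 - Real.log (hH.eigenvalues i) :=
      fun i _ => by linarith [Real.log_le_sub_one_of_pos (hpos i)]
    have := (Finset.sum_eq_zero_iff_of_nonneg h0).1 hlog i (Finset.mem_univ i)
    by_contra hne
    linarith [Real.log_lt_sub_one_of_pos (hpos i) hne]
  have hev : hH.eigenvalues = fun _ => 1 := funext hone
  have := hH.spectral_theorem
  rw [hev] at this
  rw [this]
  have h1 : (RCLike.ofReal ∘ fun _ : n => (1 : ℝ)) = fun _ => (1 : ℝ) := by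
    funext; simp
  rw [h1, Matrix.diagonal_one, map_one]

theorem Matrix.gram_eq_diagonal_iff {n E : Type*} [DecidableEq n] [NormedAddCommGroup E]
    [InnerProductSpace ℝ E] {v : n → E} :
    Matrix.gram ℝ v = Matrix.diagonal (fun i => ‖v i‖ ^ 2) ↔
      Pairwise fun i j => inner ℝ (v i) (v j) = 0 := by
  constructor
  · intro h i j hij
    have := congrFun (congrFun h i) j
    rwa [Matrix.gram_apply, Matrix.diagonal_apply_ne _ hij] at this
  · intro h
    ext i j
    rcases eq_or_ne i j with rfl | hij
    · simp [Matrix.gram_apply]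
    · rw [Matrix.gram_apply, Matrix.diagonal_apply_ne _ hij, h hij]

/-- The case of equality in Hadamard's inequality: the Gram determinant of nonzero vectors is the
product of their squared norms exactly when they are pairwise orthogonal. -/
theorem Matrix.det_gram_eq_prod_iff {n E : Type*} [Fintype n] [DecidableEq n]
    [NormedAddCommGroup E] [InnerProductSpace ℝ E] {v : n → E} (hv : ∀ i, v i ≠ 0) :
    (Matrix.gram ℝ v).det = ∏ i, ‖v i‖ ^ 2 ↔ Pairwise fun i j => inner ℝ (v i) (v j) = 0 := by
  rw [← Matrix.gram_eq_diagonal_iff]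
  refine ⟨fun h => ?_, fun h => by rw [h, Matrix.det_diagonal]⟩
  -- The Gram matrix `N` of the normalised vectors has determinant `1` and ones on the diagonal.
  set N : Matrix n n ℝ := Matrix.gram ℝ fun i => ‖v i‖⁻¹ • v i with hN
  have hfac : Matrix.gram ℝ v =
      Matrix.diagonal (fun i => ‖v i‖) * N * Matrix.diagonal (fun i => ‖v i‖) := by
    ext i j
    rw [Matrix.mul_diagonal, Matrix.diagonal_mul, hN, Matrix.gram_apply, Matrix.gram_apply,
      real_inner_smul_left, real_inner_smul_right]
    have := norm_ne_zero_iff.2 (hv i)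
    have := norm_ne_zero_iff.2 (hv j)
    field_simp
  have hdet : N.det = 1 := by
    have h1 := congrArg Matrix.det hfac
    rw [h, Matrix.det_mul, Matrix.det_mul, Matrix.det_diagonal, Finset.prod_pow] at h1
    have h2 : ∏ i, ‖v i‖ ≠ 0 := Finset.prod_ne_zero_iff.2 fun i _ => norm_ne_zero_iff.2 (hv i)
    have h3 : (∏ i, ‖v i‖) ^ 2 * (N.det - 1) = 0 := by linear_combination -h1
    rcases mul_eq_zero.1 h3 with h4 | h4
    · exact absurd h4 (pow_ne_zero 2 h2)
    · linarith
  have htr : N.trace = Fintype.card n := by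
    simp only [Matrix.trace, hN, Matrix.diag_apply, Matrix.gram_apply, real_inner_self_eq_norm_sq,
      norm_smul, norm_inv, norm_norm]
    rw [Finset.sum_congr rfl fun i _ => by
      rw [inv_mul_cancel₀ (norm_ne_zero_iff.2 (hv i)), one_pow]]
    simp
  have hN1 : N = 1 := (Matrix.posSemidef_gram ℝ _).eq_one_of_det_of_trace hdet htr
  rw [hfac, hN1, Matrix.mul_one, Matrix.diagonal_mul_diagonal]
  simp [sq]

/-! ### The constraint on the singular value decomposition -/

namespace Disentanglement

variable {d m : ℕ} {g : EuclideanSpace ℝ (Fin d) → EuclideanSpace ℝ (Fin m)}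

/-- The speed `‖∂g/∂z_i‖` of `g` along the `i`-th axis. -/
noncomputable def speed {d m : ℕ} (g : EuclideanSpace ℝ (Fin d) → EuclideanSpace ℝ (Fin m))
    (i : Fin d) (z : EuclideanSpace ℝ (Fin d)) : ℝ := ‖fderiv ℝ g z (axis i)‖

theorem axis_ne_zero (i : Fin d) : (axis i : EuclideanSpace ℝ (Fin d)) ≠ 0 := by
  simp [axis]

theorem speed_pos {z : EuclideanSpace ℝ (Fin d)} (hz : Function.Injective (fderiv ℝ g z))
    (i : Fin d) : 0 < speed g i z :=
  norm_pos_iff.2 fun h => axis_ne_zero i (hz (h.trans (map_zero _).symm))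

/-- Hadamard's inequality for the Jacobian is an equality exactly when its columns are pairwise
orthogonal. -/
theorem volumeFactor_eq_prod_iff {z : EuclideanSpace ℝ (Fin d)}
    (hz : Function.Injective (fderiv ℝ g z)) :
    volumeFactor g z = ∏ i, speed g i z ↔
      Pairwise fun i j => inner ℝ (fderiv ℝ g z (axis i)) (fderiv ℝ g z (axis j)) = 0 := by
  rw [← Matrix.det_gram_eq_prod_iff fun i => norm_pos_iff.1 (speed_pos hz i)]
  have h := LinearMap.normDet_sq_eq_det_gram (fderiv ℝ g z).toLinearMap
    (EuclideanSpace.basisFun (Fin d) ℝ)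
  simp only [EuclideanSpace.basisFun_apply, RCLike.ofReal_real_eq_id, id] at h
  change volumeFactor g z ^ 2 = (Matrix.gram ℝ fun i => fderiv ℝ g z (axis i)).det at h
  rw [← h, Finset.prod_pow]
  exact (sq_eq_sq₀ (volumeFactor_pos hz).le (Finset.prod_nonneg fun i _ => norm_nonneg _)).symm

theorem jacobian_transpose_mul (z : EuclideanSpace ℝ (Fin d)) :
    (jacobian g z)ᵀ * jacobian g z = Matrix.gram ℝ fun i => fderiv ℝ g z (axis i) := by
  ext i j
  simp [Matrix.mul_apply, jacobian, Matrix.gram_apply, PiLp.inner_apply, mul_comm]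

/-- If the right singular vectors are the standard basis vectors, then `JᵀJ` is diagonal with entries
`s i ^ 2`. -/
theorem IsSVD.eq_speed {z : EuclideanSpace ℝ (Fin d)} {U : Matrix (Fin m) (Fin d) ℝ}
    {s : Fin d → ℝ} (h : IsSVD (jacobian g z) U s 1) :
    (∀ i, s i = speed g i z) ∧
      Pairwise fun i j => inner ℝ (fderiv ℝ g z (axis i)) (fderiv ℝ g z (axis j)) = 0 := by
  have h1 : Matrix.gram ℝ (fun i => fderiv ℝ g z (axis i)) = Matrix.diagonal fun i => s i * s i := by
    rw [← jacobian_transpose_mul, h.eq]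
    simp only [Matrix.transpose_one, Matrix.mul_one, Matrix.transpose_mul,
      Matrix.diagonal_transpose]
    rw [Matrix.mul_assoc, ← Matrix.mul_assoc Uᵀ, h.left_orthonormal, Matrix.one_mul,
      Matrix.diagonal_mul_diagonal]
  constructor
  · intro i
    have := congrFun (congrFun h1 i) i
    rw [Matrix.gram_apply, Matrix.diagonal_apply_eq, real_inner_self_eq_norm_sq, ← sq] at this
    exact ((sq_eq_sq₀ (norm_nonneg _) (h.nonneg i)).1 this).symm
  · intro i j hij
    have := congrFun (congrFun h1 i) j
    rwa [Matrix.gram_apply, Matrix.diagonal_apply_ne _ hij] at this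

/-- Orthogonal columns are made orthonormal by dividing them by their norms. -/
theorem exists_isSVD_speed {z : EuclideanSpace ℝ (Fin d)}
    (hz : Function.Injective (fderiv ℝ g z))
    (h : Pairwise fun i j => inner ℝ (fderiv ℝ g z (axis i)) (fderiv ℝ g z (axis j)) = 0) :
    ∃ U, IsSVD (jacobian g z) U (fun i => speed g i z) 1 := by
  have h0 : ∀ i, speed g i z ≠ 0 := fun i => (speed_pos hz i).ne'
  have hgram : (jacobian g z)ᵀ * jacobian g z = Matrix.diagonal fun i => speed g i z ^ 2 := by
    rw [jacobian_transpose_mul]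
    exact Matrix.gram_eq_diagonal_iff.2 h
  refine ⟨jacobian g z * Matrix.diagonal fun i => (speed g i z)⁻¹, ?_, by simp, by simp,
    fun i => norm_nonneg _, ?_⟩
  · rw [Matrix.transpose_mul, Matrix.diagonal_transpose, Matrix.mul_assoc,
      ← Matrix.mul_assoc (jacobian g z)ᵀ, hgram, Matrix.diagonal_mul_diagonal,
      Matrix.diagonal_mul_diagonal, ← Matrix.diagonal_one]
    congr 1
    funext i
    have := h0 i
    field_simp
  · rw [Matrix.transpose_one, Matrix.mul_one, Matrix.mul_assoc, Matrix.diagonal_mul_diagonal]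
    simp [h0]

end Disentanglement

/-! ### Arc length on a line -/

namespace Disentanglement

section ArcLength

open Set Filter

/-- `s` is the speed of a parametrised curve of locally finite length that almost never stops. -/
structure IsSpeed (s : ℝ → ℝ) : Prop where
  measurable : Measurable s
  locallyIntegrable : LocallyIntegrable s
  pos : ∀ᵐ t, 0 < s t

namespace IsSpeed

variable {s : ℝ → ℝ}

theorem intervalIntegrable (hs : IsSpeed s) (x y : ℝ) : IntervalIntegrable s volume x y :=
  (hs.locallyIntegrable.integrableOn_isCompact isCompact_uIcc).intervalIntegrable

theorem sub_integral (hs : IsSpeed s) (b x y : ℝ) :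
    (∫ t in b..y, s t) - ∫ t in b..x, s t = ∫ t in x..y, s t :=
  intervalIntegral.integral_interval_sub_left (hs.intervalIntegrable _ _) (hs.intervalIntegrable _ _)

theorem strictMono (hs : IsSpeed s) (b : ℝ) : StrictMono fun x => ∫ t in b..x, s t := by
  intro x y hxy
  rw [← sub_pos, hs.sub_integral, intervalIntegral.integral_pos_iff_support_of_nonneg_ae
    (hs.pos.mono fun t ht => ht.le) (hs.intervalIntegrable _ _)]
  refine ⟨hxy, ?_⟩
  have : (Function.support s ∩ Ioc x y : Set ℝ) =ᵐ[volume] Ioc x y := by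
    filter_upwards [hs.pos] with t ht
    exact propext ⟨fun h => h.2, fun h => ⟨ht.ne', h⟩⟩
  rw [measure_congr this, Real.volume_Ioc]
  simpa using hxy

theorem continuous (hs : IsSpeed s) (b : ℝ) : Continuous fun x => ∫ t in b..x, s t :=
  intervalIntegral.continuous_primitive (fun _ _ => hs.intervalIntegrable _ _) b

theorem ae_hasDerivAt (hs : IsSpeed s) (b : ℝ) :
    ∀ᵐ x, HasDerivAt (fun x => ∫ t in b..x, s t) (s x) x := by
  filter_upwards [LocallyIntegrable.ae_hasDerivAt_integral hs.locallyIntegrable] with x hx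
  exact hx b

theorem measurableEmbedding (hs : IsSpeed s) (b : ℝ) :
    MeasurableEmbedding fun x => ∫ t in b..x, s t :=
  (hs.continuous b).measurableEmbedding (hs.strictMono b).injective

/-- The change of variables to arc length. -/
theorem exists_lintegral_image (hs : IsSpeed s) (b : ℝ) :
    ∃ T : Set ℝ, MeasurableSet T ∧ (∀ᵐ t, t ∈ T) ∧ ∀ A : Set ℝ, MeasurableSet A → A ⊆ T →
      ∀ f : ℝ → ℝ≥0∞, ∫⁻ u in (fun x => ∫ t in b..x, s t) '' A, f u =
        ∫⁻ t in A, ENNReal.ofReal (s t) * f (∫ τ in b..t, s τ) := by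
  obtain ⟨T, hT, hTm, hTs⟩ := ((hs.ae_hasDerivAt b).and hs.pos).exists_measurable_mem
  refine ⟨T, hTm, hT, fun A hA hAT f => ?_⟩
  rw [lintegral_image_eq_lintegral_abs_deriv_mul hA
    (fun x hx => (hTs x (hAT hx)).1.hasDerivWithinAt) (hs.strictMono b).injective.injOn]
  refine setLIntegral_congr_fun hA fun t ht => ?_
  simp only [abs_of_pos (hTs t (hAT ht)).2]

variable {p : ℝ → ℝ}

theorem map_marginal_absolutelyContinuous (hs : IsSpeed s) (b : ℝ) :
    (marginal p).map (fun x => ∫ t in b..x, s t) ≪ volume := by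
  obtain ⟨T, hTm, hT, hTA⟩ := hs.exists_lintegral_image b
  refine Measure.AbsolutelyContinuous.mk fun N hN hN0 => ?_
  have hm : Measurable fun x => ∫ t in b..x, s t := (hs.continuous b).measurable
  rw [Measure.map_apply hm hN]
  refine withDensity_absolutelyContinuous volume _ ?_
  set A := (fun x => ∫ t in b..x, s t) ⁻¹' N ∩ T with hA
  have hAm : MeasurableSet A := (hm hN).inter hTm
  have h1 := hTA A hAm inter_subset_right 1
  have h2 : volume ((fun x => ∫ t in b..x, s t) '' A) = 0 := by
    refine measure_mono_null ?_ hN0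
    rintro _ ⟨t, ht, rfl⟩
    exact ht.1
  simp only [Pi.one_apply, mul_one, lintegral_one, Measure.restrict_apply_univ, h2] at h1
  have h3 := (setLIntegral_eq_zero_iff hAm hs.measurable.ennreal_ofReal).1 h1.symm
  rw [measure_eq_zero_iff_ae_notMem]
  filter_upwards [h3, hT, hs.pos] with t h3 hT hpos htN
  have := h3 ⟨htN, hT⟩
  simp only [ENNReal.ofReal_eq_zero] at this
  linarith

/-- The density `f` of the law with density `p` in the arc-length coordinate satisfies
`s(t) f(u(t)) = p(t)`. -/
theorem mul_density (hs : IsSpeed s) (b : ℝ) (hp : Measurable p)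
    {f : ℝ → ℝ≥0∞} (hf : Measurable f)
    (h : (marginal p).map (fun x => ∫ t in b..x, s t) = volume.withDensity f) :
    ∀ᵐ t, ENNReal.ofReal (s t) * f (∫ τ in b..t, s τ) = ENNReal.ofReal (p t) := by
  obtain ⟨T, hTm, hT, hTA⟩ := hs.exists_lintegral_image b
  have hm : Measurable fun x => ∫ t in b..x, s t := (hs.continuous b).measurable
  have hm2 : Measurable fun t => ENNReal.ofReal (s t) * f (∫ τ in b..t, s τ) :=
    hs.measurable.ennreal_ofReal.mul (hf.comp hm)
  refine (withDensity_eq_iff_of_sigmaFinite hm2.aemeasurable hp.ennreal_ofReal.aemeasurable).1 ?_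
  ext A hA
  have hAT : (A : Set ℝ) =ᵐ[volume] (A ∩ T : Set ℝ) := by
    filter_upwards [hT] with z hz
    exact propext ⟨fun h => ⟨h, hz⟩, fun h => h.1⟩
  have himg : MeasurableSet ((fun x => ∫ t in b..x, s t) '' (A ∩ T)) :=
    (hs.measurableEmbedding b).measurableSet_image.2 (hA.inter hTm)
  have h1 := congrArg (fun μ => μ ((fun x => ∫ t in b..x, s t) '' (A ∩ T))) h
  rw [Measure.map_apply hm himg, preimage_image_eq _ (hs.strictMono b).injective, marginal,
    withDensity_apply _ (hA.inter hTm), withDensity_apply _ himg,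
    hTA _ (hA.inter hTm) inter_subset_right] at h1
  rw [withDensity_apply _ hA, withDensity_apply _ hA, setLIntegral_congr hAT,
    setLIntegral_congr hAT, h1]

end IsSpeed
end ArcLength
end Disentanglement

/-! ### Product laws and axis-aligned lines -/

namespace Disentanglement

section Lines

open Set Filter

variable {d : ℕ}

@[simp]
theorem move_apply (z : EuclideanSpace ℝ (Fin d)) (i : Fin d) (t : ℝ) (j : Fin d) :
    move z i t j = if j = i then t else z j := by
  simp [move, Function.update_apply]

@[simp]
theorem move_move (z : EuclideanSpace ℝ (Fin d)) (i : Fin d) (t t' : ℝ) :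
    move (move z i t) i t' = move z i t' := by
  simp [move]

theorem move_eq_add_smul (z : EuclideanSpace ℝ (Fin d)) (i : Fin d) (t : ℝ) :
    move z i t = z + (t - z i) • axis i := by
  ext j
  by_cases h : j = i <;> simp [axis, h]

theorem measurable_move (i : Fin d) :
    Measurable fun x : EuclideanSpace ℝ (Fin d) × ℝ => move x.1 i x.2 := by
  have : (fun x : EuclideanSpace ℝ (Fin d) × ℝ => move x.1 i x.2) =
      fun x => x.1 + (x.2 - x.1 i) • axis i := funext fun x => move_eq_add_smul _ _ _
  rw [this]
  fun_prop

/-- The product law on Euclidean space. -/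
noncomputable def piLaw {d : ℕ} (μ : Fin d → Measure ℝ) : Measure (EuclideanSpace ℝ (Fin d)) :=
  (Measure.pi μ).map (WithLp.toLp 2)

variable {μ : Fin d → Measure ℝ}

theorem measurable_toLp :
    Measurable (WithLp.toLp 2 : (Fin d → ℝ) → EuclideanSpace ℝ (Fin d)) :=
  (MeasurableEquiv.toLp 2 (Fin d → ℝ)).measurable

instance [∀ i, IsProbabilityMeasure (μ i)] : IsProbabilityMeasure (piLaw μ) :=
  Measure.isProbabilityMeasure_map measurable_toLp.aemeasurable

theorem measurePreserving_update [∀ i, IsProbabilityMeasure (μ i)] (i : Fin d) :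
    MeasurePreserving (fun x : (Fin d → ℝ) × ℝ => Function.update x.1 i x.2)
      ((Measure.pi μ).prod (μ i)) (Measure.pi μ) := by
  have hm : Measurable fun x : (Fin d → ℝ) × ℝ => Function.update x.1 i x.2 := by
    refine measurable_pi_iff.2 fun j => ?_
    by_cases h : j = i
    · subst h
      simpa using measurable_snd
    · simp only [Function.update_of_ne h]
      fun_prop
  refine ⟨hm, (Measure.pi_eq fun s hs => ?_).symm⟩
  have hpre : (fun x : (Fin d → ℝ) × ℝ => Function.update x.1 i x.2) ⁻¹' (univ.pi s) =
      (univ.pi (Function.update s i univ)) ×ˢ s i := by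
    ext x
    simp only [mem_preimage, Set.mem_pi, mem_univ, true_imp_iff, mem_prod]
    constructor
    · intro h
      refine ⟨fun j => ?_, by simpa using h i⟩
      by_cases hj : j = i
      · subst hj; simp
      · simpa [hj] using h j
    · rintro ⟨h1, h2⟩ j
      by_cases hj : j = i
      · subst hj; simpa using h2
      · simpa [hj] using h1 j
  rw [Measure.map_apply hm (MeasurableSet.univ_pi hs), hpre, Measure.prod_prod, Measure.pi_pi,
    ← Finset.mul_prod_erase _ _ (Finset.mem_univ i),
    ← Finset.mul_prod_erase _ (fun j => μ j (s j)) (Finset.mem_univ i)]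
  simp only [Function.update_self, measure_univ, one_mul]
  rw [mul_comm]
  congr 1
  refine Finset.prod_congr rfl fun j hj => ?_
  rw [Function.update_of_ne (Finset.ne_of_mem_erase hj)]

/-- Resampling one coordinate of a point preserves a product law. -/
theorem measurePreserving_move [∀ i, IsProbabilityMeasure (μ i)] (i : Fin d) :
    MeasurePreserving (fun x : EuclideanSpace ℝ (Fin d) × ℝ => move x.1 i x.2)
      ((piLaw μ).prod (μ i)) (piLaw μ) := by
  have h1 := (measurePreserving_update (μ := μ) i)
  refine ⟨measurable_move i, ?_⟩
  have h2 : (piLaw μ).prod (μ i) =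
      ((Measure.pi μ).prod (μ i)).map (Prod.map (WithLp.toLp 2) id) := by
    rw [← Measure.map_prod_map _ _ measurable_toLp measurable_id, Measure.map_id, piLaw]
  rw [h2, Measure.map_map (measurable_move i) (measurable_toLp.prodMap measurable_id)]
  conv_rhs => rw [piLaw, ← h1.map_eq, Measure.map_map measurable_toLp h1.measurable]
  rfl

/-- Fubini's theorem for axis-aligned lines: a property that holds almost everywhere holds almost
everywhere on the `i`-th line through almost every point. -/
theorem ae_ae_move [∀ i, IsProbabilityMeasure (μ i)] (i : Fin d)
    {P : EuclideanSpace ℝ (Fin d) → Prop} (h : ∀ᵐ z ∂(piLaw μ), P z) :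
    ∀ᵐ z ∂(piLaw μ), ∀ᵐ t ∂(μ i), P (move z i t) :=
  Measure.ae_ae_of_ae_prod ((measurePreserving_move i).quasiMeasurePreserving.ae h)

theorem ae_of_ae_ae_move [∀ i, IsProbabilityMeasure (μ i)] (i : Fin d)
    {P : EuclideanSpace ℝ (Fin d) → Prop} (hP : MeasurableSet {z | P z})
    (h : ∀ᵐ z ∂(piLaw μ), ∀ᵐ t ∂(μ i), P (move z i t)) : ∀ᵐ z ∂(piLaw μ), P z := by
  have h1 := (Measure.ae_prod_iff_ae_ae (p := fun x => P (move x.1 i x.2))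
    (measurable_move i hP)).2 h
  rw [← (measurePreserving_move (μ := μ) i).map_eq]
  exact (ae_map_iff (measurable_move i).aemeasurable hP).2 h1

theorem measurePreserving_coordinate [∀ i, IsProbabilityMeasure (μ i)] (i : Fin d) :
    MeasurePreserving (fun z : EuclideanSpace ℝ (Fin d) => z i) (piLaw μ) (μ i) := by
  have hm : Measurable fun z : EuclideanSpace ℝ (Fin d) => z i := by fun_prop
  refine ⟨hm, ?_⟩
  rw [piLaw, Measure.map_map hm measurable_toLp]
  exact (measurePreserving_eval μ i).map_eq

end Lines
end Disentanglement

/-! ### Factorised priors -/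

namespace Disentanglement

section Prior

open Set Filter

variable {d : ℕ}

/-- The `p i` are probability densities that are positive exactly on the open intervals `I i`, up
to null sets. -/
structure IsFactorisedPrior {d : ℕ} (p : Fin d → ℝ → ℝ) (I : Fin d → Set ℝ) : Prop where
  measurable : ∀ i, Measurable (p i)
  nonneg : ∀ i t, 0 ≤ p i t
  lintegral_eq_one : ∀ i, ∫⁻ t, ENNReal.ofReal (p i t) = 1
  isOpen : ∀ i, IsOpen (I i)
  ordConnected : ∀ i, (I i).OrdConnected
  pos_iff : ∀ i, ∀ᵐ t, 0 < p i t ↔ t ∈ I i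

theorem ae_coordinate {i : Fin d} {P : ℝ → Prop} (h : ∀ᵐ t, P t) :
    ∀ᵐ z : EuclideanSpace ℝ (Fin d), P (z i) := by
  have h1 : ∀ᵐ x : Fin d → ℝ, P (x i) :=
    (Measure.quasiMeasurePreserving_eval (fun _ : Fin d => (volume : Measure ℝ)) i).ae h
  exact (PiLp.volume_preserving_ofLp (Fin d)).quasiMeasurePreserving.ae h1

theorem isOpen_box {I : Fin d → Set ℝ} (hI : ∀ i, IsOpen (I i)) : IsOpen (box I) := by
  have : box I = ⋂ i, (fun z : EuclideanSpace ℝ (Fin d) => z i) ⁻¹' I i := by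
    ext z; simp [box]
  rw [this]
  exact isOpen_iInter_of_finite fun i => (hI i).preimage (by fun_prop)

namespace IsFactorisedPrior

variable {p : Fin d → ℝ → ℝ} {I : Fin d → Set ℝ}

theorem isProbabilityMeasure (h : IsFactorisedPrior p I) (i : Fin d) :
    IsProbabilityMeasure (marginal (p i)) :=
  ⟨by rw [marginal, withDensity_apply _ .univ, Measure.restrict_univ, h.lintegral_eq_one]⟩

theorem ae_marginal_iff (h : IsFactorisedPrior p I) {i : Fin d} {P : ℝ → Prop} :
    (∀ᵐ t ∂(marginal (p i)), P t) ↔ ∀ᵐ t, t ∈ I i → P t := by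
  rw [marginal, ae_withDensity_iff (h.measurable i).ennreal_ofReal]
  refine eventually_congr ?_
  filter_upwards [h.pos_iff i] with t ht
  rw [← ht]
  simp

theorem ae_prior_iff (h : IsFactorisedPrior p I) {P : EuclideanSpace ℝ (Fin d) → Prop} :
    (∀ᵐ z ∂(prior p), P z) ↔ ∀ᵐ z, z ∈ box I → P z := by
  rw [prior, ae_withDensity_iff (measurable_priorDensity h.measurable)]
  refine eventually_congr ?_
  filter_upwards [ae_all_iff.2 fun i => ae_coordinate (i := i) (h.pos_iff i)] with z hz
  have : ENNReal.ofReal (∏ i, p i (z i)) ≠ 0 ↔ z ∈ box I := by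
    simp only [ne_eq, ENNReal.ofReal_eq_zero, not_le]
    constructor
    · intro h0 i
      rw [← hz i]
      exact (h.nonneg i _).lt_of_ne' fun h1 => h0.ne' (Finset.prod_eq_zero (Finset.mem_univ i) h1)
    · intro hzI
      exact Finset.prod_pos fun i _ => (hz i).2 (hzI i)
  rw [this]

theorem ae_mem_box (h : IsFactorisedPrior p I) : ∀ᵐ z ∂(prior p), z ∈ box I :=
  h.ae_prior_iff.2 (Eventually.of_forall fun _ => id)

theorem ae_prior_of_ae (h : IsFactorisedPrior p I) {P : EuclideanSpace ℝ (Fin d) → Prop}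
    (hP : ∀ᵐ z, P z) : ∀ᵐ z ∂(prior p), P z :=
  h.ae_prior_iff.2 (hP.mono fun _ hz _ => hz)

theorem ae_marginal_of_ae (h : IsFactorisedPrior p I) {i : Fin d} {P : ℝ → Prop}
    (hP : ∀ᵐ t, P t) : ∀ᵐ t ∂(marginal (p i)), P t :=
  h.ae_marginal_iff.2 (hP.mono fun _ hz _ => hz)

theorem integrable (h : IsFactorisedPrior p I) (i : Fin d) : Integrable (p i) := by
  refine ⟨(h.measurable i).aestronglyMeasurable, ?_⟩
  rw [hasFiniteIntegral_iff_ofReal (Eventually.of_forall (h.nonneg i)), h.lintegral_eq_one]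
  exact ENNReal.one_lt_top

/-- The factorised prior is the product of its marginals. -/
theorem prior_eq (h : IsFactorisedPrior p I) : prior p = piLaw fun i => marginal (p i) := by
  have hprob := h.isProbabilityMeasure
  have hq := measurable_priorDensity h.measurable
  have e1 : (prior p).map (WithLp.ofLp : _ → Fin d → ℝ) = Measure.pi fun i => marginal (p i) := by
    symm
    refine Measure.pi_eq fun s hs => ?_
    have hm : Measurable (WithLp.ofLp : EuclideanSpace ℝ (Fin d) → Fin d → ℝ) :=
      (PiLp.volume_preserving_ofLp (Fin d)).measurable
    rw [Measure.map_apply hm (.univ_pi hs), prior, withDensity_apply _ (hm (.univ_pi hs)),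
      ← lintegral_indicator (hm (.univ_pi hs))]
    have hind : ∀ z : EuclideanSpace ℝ (Fin d),
        ((WithLp.ofLp : EuclideanSpace ℝ (Fin d) → Fin d → ℝ) ⁻¹' univ.pi s).indicator
          (fun z => ENNReal.ofReal (∏ i, p i (z i))) z =
        ENNReal.ofReal (∏ i, (s i).indicator (p i) (WithLp.ofLp z i)) := by
      intro z
      by_cases hz : ∀ i, z i ∈ s i
      · rw [indicator_of_mem (by simpa [Set.mem_pi] using hz)]
        congr 1
        exact Finset.prod_congr rfl fun i _ => (indicator_of_mem (hz i) _).symm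
      · rw [indicator_of_notMem (by simpa [Set.mem_pi] using hz)]
        push Not at hz
        obtain ⟨i, hi⟩ := hz
        rw [Finset.prod_eq_zero (Finset.mem_univ i) (indicator_of_notMem hi _), ENNReal.ofReal_zero]
    simp only [hind]
    have hnn : ∀ i t, 0 ≤ (s i).indicator (p i) t :=
      fun i t => indicator_nonneg (fun t _ => h.nonneg i t) t
    have hint : ∀ i, Integrable ((s i).indicator (p i)) := fun i => (h.integrable i).indicator (hs i)
    rw [(PiLp.volume_preserving_ofLp (Fin d)).lintegral_comp
        (f := fun x : Fin d → ℝ => ENNReal.ofReal (∏ i, (s i).indicator (p i) (x i)))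
        (Finset.measurable_prod _ fun i _ =>
          ((h.measurable i).indicator (hs i)).comp (measurable_pi_apply i)).ennreal_ofReal,
      volume_pi, ← ofReal_integral_eq_lintegral_ofReal (Integrable.fintype_prod hint)
        (Eventually.of_forall fun x => Finset.prod_nonneg fun i _ => hnn i _),
      integral_fintype_prod_eq_prod,
      ENNReal.ofReal_prod_of_nonneg fun i _ => integral_nonneg (hnn i)]
    refine Finset.prod_congr rfl fun i _ => ?_
    rw [ofReal_integral_eq_lintegral_ofReal (hint i) (Eventually.of_forall (hnn i)), marginal,
      withDensity_apply _ (hs i), ← lintegral_indicator (hs i)]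
    congr 1
    funext t
    by_cases ht : t ∈ s i <;> simp [ht]
  rw [piLaw, ← e1, Measure.map_map measurable_toLp
    (PiLp.volume_preserving_ofLp (Fin d)).measurable]
  have : (WithLp.toLp 2 ∘ WithLp.ofLp : EuclideanSpace ℝ (Fin d) → EuclideanSpace ℝ (Fin d)) =
    id := rfl
  rw [this, Measure.map_id]

end IsFactorisedPrior

end Prior
end Disentanglement

/-! ### Length along axis-aligned lines -/

namespace Disentanglement

section LineSpeed

open Set Filter Topology

variable {d m : ℕ} {g : EuclideanSpace ℝ (Fin d) → EuclideanSpace ℝ (Fin m)}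

theorem measurable_speed (i : Fin d) : Measurable (speed g i) :=
  (measurable_fderiv_apply_const ℝ g (axis i)).norm

theorem speed_nonneg (i : Fin d) (z : EuclideanSpace ℝ (Fin d)) : 0 ≤ speed g i z :=
  norm_nonneg _

theorem locallyIntegrable_speed (hloc : LocallyIntegrable (fun z => fderiv ℝ g z)) (i : Fin d) :
    LocallyIntegrable (speed g i) := fun z => by
  obtain ⟨u, hu, hint⟩ := hloc z
  exact ⟨u, hu, (((ContinuousLinearMap.apply ℝ (EuclideanSpace ℝ (Fin m))) (axis i)).integrable_comp
    hint).norm⟩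

theorem coord_eq (b : EuclideanSpace ℝ (Fin d)) (i : Fin d) (z : EuclideanSpace ℝ (Fin d)) :
    coord g b i z = ∫ t in (b i)..(z i), speed g i (move z i t) := rfl

theorem coord_move (b : EuclideanSpace ℝ (Fin d)) (i : Fin d) (z : EuclideanSpace ℝ (Fin d))
    (x : ℝ) : coord g b i (move z i x) = ∫ t in (b i)..x, speed g i (move z i t) := by
  simp [coord_eq]

theorem measurable_coord (b : EuclideanSpace ℝ (Fin d)) (i : Fin d) :
    Measurable (coord g b i) := by
  have hs : Measurable fun x : EuclideanSpace ℝ (Fin d) × ℝ => speed g i (move x.1 i x.2) :=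
    (measurable_speed i).comp (measurable_move i)
  have hz : Measurable fun x : EuclideanSpace ℝ (Fin d) × ℝ => x.1 i := by fun_prop
  have key : ∀ S : Set (EuclideanSpace ℝ (Fin d) × ℝ), MeasurableSet S →
      Measurable fun z => ∫ t in {t | (z, t) ∈ S}, speed g i (move z i t) := by
    intro S hS
    have h1 : StronglyMeasurable (S.indicator
      fun x : EuclideanSpace ℝ (Fin d) × ℝ => speed g i (move x.1 i x.2)) :=
      (hs.indicator hS).stronglyMeasurable
    have h2 := (h1.integral_prod_right' (ν := (volume : Measure ℝ))).measurable
    convert h2 using 2 with z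
    exact (integral_indicator (measurable_prodMk_left hS)).symm
  have h1 := key {x | x.2 ∈ Ioc (b i) (x.1 i)}
    ((measurableSet_lt measurable_const measurable_snd).inter (measurableSet_le measurable_snd hz))
  have h2 := key {x | x.2 ∈ Ioc (x.1 i) (b i)}
    ((measurableSet_lt hz measurable_snd).inter (measurableSet_le measurable_snd measurable_const))
  exact h1.sub h2

/-- The uniform law on the cube `(-n, n)ᵈ`. -/
theorem isFactorisedPrior_uniform {n : ℝ} (hn : 0 < n) :
    IsFactorisedPrior (fun _ : Fin d => (Ioo (-n) n).indicator fun _ => (2 * n)⁻¹)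
      fun _ => Ioo (-n) n where
  measurable _ := measurable_const.indicator measurableSet_Ioo
  nonneg _ t := indicator_nonneg (fun _ _ => by positivity) t
  lintegral_eq_one _ := by
    have : (fun t => ENNReal.ofReal ((Ioo (-n) n).indicator (fun _ => (2 * n)⁻¹) t)) =
        (Ioo (-n) n).indicator fun _ => ENNReal.ofReal (2 * n)⁻¹ := by
      funext t
      by_cases ht : t ∈ Ioo (-n) n <;> simp [ht]
    rw [this, lintegral_indicator measurableSet_Ioo, setLIntegral_const, Real.volume_Ioo,
      ← ENNReal.ofReal_mul (by positivity)]
    have : (2 * n)⁻¹ * (n - -n) = 1 := by field_simp; ring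
    rw [this, ENNReal.ofReal_one]
  isOpen _ := isOpen_Ioo
  ordConnected _ := ordConnected_Ioo
  pos_iff _ := Eventually.of_forall fun t => by
    by_cases ht : t ∈ Ioo (-n) n <;> simp [ht, hn]

theorem marginal_uniform (n : ℝ) :
    marginal ((Ioo (-n) n).indicator fun _ => (2 * n)⁻¹) =
      ENNReal.ofReal (2 * n)⁻¹ • volume.restrict (Ioo (-n) n) := by
  have : (fun t => ENNReal.ofReal ((Ioo (-n) n).indicator (fun _ => (2 * n)⁻¹) t)) =
      (Ioo (-n) n).indicator fun _ => ENNReal.ofReal (2 * n)⁻¹ := by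
    funext t
    by_cases ht : t ∈ Ioo (-n) n <;> simp [ht]
  rw [marginal, this, withDensity_indicator measurableSet_Ioo, withDensity_const]

/-- Fubini's theorem for the uniform law on a cube: the speed has finite integral over the part in the
cube of almost every axis-aligned line that meets it, and almost never vanishes there. -/
theorem ae_isSpeed_of_mem_cube (hrank : ∀ᵐ z, Function.Injective (fderiv ℝ g z))
    (hloc : LocallyIntegrable (fun z => fderiv ℝ g z)) (i : Fin d) {n : ℝ} (hn : 0 < n) :
    ∀ᵐ z : EuclideanSpace ℝ (Fin d), z ∈ box (fun _ => Ioo (-n) n) →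
      IntegrableOn (fun t => speed g i (move z i t)) (Ioo (-n) n) ∧
      ∀ᵐ t, t ∈ Ioo (-n) n → 0 < speed g i (move z i t) := by
  have hpr := isFactorisedPrior_uniform (d := d) hn
  have hprob := hpr.isProbabilityMeasure i
  rw [← hpr.ae_prior_iff]
  have h1 : ∀ᵐ z : EuclideanSpace ℝ (Fin d), 0 < speed g i z :=
    hrank.mono fun z hz => speed_pos hz i
  have h2 := hpr.ae_prior_of_ae h1
  rw [hpr.prior_eq] at h2 ⊢
  have h3 := ae_ae_move i h2
  have hms := measurable_speed (g := g) i
  -- The uniform law has a bounded density, and the speed is integrable over the closed cube.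
  have hfin : ∫⁻ z, ENNReal.ofReal (speed g i z)
      ∂(prior fun _ : Fin d => (Ioo (-n) n).indicator fun _ => (2 * n)⁻¹) ≠ ⊤ := by
    have hK : IsCompact ((WithLp.toLp 2 : (Fin d → ℝ) → EuclideanSpace ℝ (Fin d)) ''
        univ.pi fun _ => Icc (-n) n) :=
      (isCompact_univ_pi fun _ => isCompact_Icc).image (PiLp.continuous_toLp 2 _)
    set K := (WithLp.toLp 2 : (Fin d → ℝ) → EuclideanSpace ℝ (Fin d)) '' univ.pi fun _ => Icc (-n) n
    have hint : IntegrableOn (speed g i) K :=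
      (locallyIntegrable_speed hloc i).integrableOn_isCompact hK
    have hle : ∀ z : EuclideanSpace ℝ (Fin d), ENNReal.ofReal
        (∏ j, (Ioo (-n) n).indicator (fun _ => (2 * n)⁻¹) (z j)) * ENNReal.ofReal (speed g i z) ≤
        ENNReal.ofReal (∏ _j : Fin d, (2 * n)⁻¹) *
          K.indicator (fun z => ENNReal.ofReal (speed g i z)) z := by
      intro z
      by_cases hz : z ∈ K
      · rw [indicator_of_mem hz]
        gcongr with j
        · exact fun _ _ => indicator_nonneg (fun _ _ => by positivity) _
        · exact indicator_le_self' (fun _ _ => by positivity) _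
      · have : ∃ j, z j ∉ Ioo (-n) n := by
          by_contra! hall
          exact hz ⟨WithLp.ofLp z, fun j _ => Ioo_subset_Icc_self (hall j), rfl⟩
        obtain ⟨j, hj⟩ := this
        rw [Finset.prod_eq_zero (Finset.mem_univ j) (indicator_of_notMem hj _)]
        simp
    rw [prior, lintegral_withDensity_eq_lintegral_mul _ (measurable_priorDensity hpr.measurable)
      hms.ennreal_ofReal]
    refine ((lintegral_mono hle).trans_lt ?_).ne
    rw [lintegral_const_mul' _ _ ENNReal.ofReal_ne_top, lintegral_indicator hK.measurableSet]
    refine ENNReal.mul_lt_top ENNReal.ofReal_lt_top ?_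
    have := hint.2
    rwa [hasFiniteIntegral_iff_ofReal (Eventually.of_forall fun z => speed_nonneg i z)] at this
  rw [hpr.prior_eq, ← (measurePreserving_move i).lintegral_comp hms.ennreal_ofReal,
    lintegral_prod (fun x => ENNReal.ofReal (speed g i (move x.1 i x.2)))
      (hms.comp (measurable_move i)).ennreal_ofReal.aemeasurable] at hfin
  have h4 := ae_lt_top
    (Measurable.lintegral_prod_right' (hms.comp (measurable_move i)).ennreal_ofReal) hfin
  filter_upwards [h3, h4] with z h3 h4
  refine ⟨?_, (hpr.ae_marginal_iff (i := i)).1 h3⟩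
  have hmeas : Measurable fun t => speed g i (move z i t) :=
    hms.comp ((measurable_move i).comp measurable_prodMk_left)
  refine ⟨hmeas.aestronglyMeasurable, ?_⟩
  rw [hasFiniteIntegral_iff_ofReal (Eventually.of_forall fun t => speed_nonneg i _)]
  rw [marginal_uniform, lintegral_smul_measure, smul_eq_mul] at h4
  refine (ENNReal.mul_lt_top_iff.1 h4).elim (fun h => h.2) fun h => ?_
  rcases h with h | h
  · exact absurd (ENNReal.ofReal_eq_zero.1 h) (not_le.2 (by positivity))
  · exact h.trans_lt ENNReal.zero_lt_top

/-- Almost every axis-aligned line is mapped to a curve of locally finite length that almost never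
stops. -/
theorem ae_isSpeed (hrank : ∀ᵐ z, Function.Injective (fderiv ℝ g z))
    (hloc : LocallyIntegrable (fun z => fderiv ℝ g z)) :
    ∀ᵐ z : EuclideanSpace ℝ (Fin d), ∀ i, IsSpeed fun t => speed g i (move z i t) := by
  have h : ∀ᵐ z : EuclideanSpace ℝ (Fin d), ∀ (i : Fin d) (n : ℕ),
      z ∈ box (fun _ => Ioo (-(n + 1 : ℝ)) (n + 1)) →
      IntegrableOn (fun t => speed g i (move z i t)) (Ioo (-(n + 1 : ℝ)) (n + 1)) ∧
      ∀ᵐ t, t ∈ Ioo (-(n + 1 : ℝ)) (n + 1) → 0 < speed g i (move z i t) :=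
    ae_all_iff.2 fun i => ae_all_iff.2 fun n =>
      ae_isSpeed_of_mem_cube hrank hloc i (by positivity)
  filter_upwards [h] with z hz i
  -- All cubes from some index on contain `z`, and together they cover the line.
  obtain ⟨N, hN⟩ := exists_nat_gt (∑ j, |z j|)
  have hbox : ∀ n : ℕ, N ≤ n → z ∈ box (fun _ : Fin d => Ioo (-(n + 1 : ℝ)) (n + 1)) := by
    intro n hn j
    have h1 : |z j| ≤ ∑ j, |z j| :=
      Finset.single_le_sum (f := fun j => |z j|) (fun j _ => abs_nonneg _) (Finset.mem_univ j)
    have h2 : (N : ℝ) ≤ n := by exact_mod_cast hn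
    exact abs_lt.1 (by linarith)
  refine ⟨(measurable_speed i).comp ((measurable_move i).comp measurable_prodMk_left), ?_, ?_⟩
  · intro t
    obtain ⟨M, hM⟩ := exists_nat_gt |t|
    have hmem : t ∈ Ioo (-((max N M : ℕ) + 1 : ℝ)) ((max N M : ℕ) + 1) := by
      have : (M : ℝ) ≤ (max N M : ℕ) := by exact_mod_cast le_max_right _ _
      exact abs_lt.1 (by linarith)
    exact ⟨_, isOpen_Ioo.mem_nhds hmem, (hz i (max N M) (hbox _ (le_max_left _ _))).1⟩
  · have : ∀ᵐ t, ∀ n : ℕ, N ≤ n → t ∈ Ioo (-(n + 1 : ℝ)) (n + 1) → 0 < speed g i (move z i t) := by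
      refine ae_all_iff.2 fun n => ?_
      by_cases hn : N ≤ n
      · filter_upwards [(hz i n (hbox n hn)).2] with t ht _ using ht
      · exact Eventually.of_forall fun t h => absurd h hn
    filter_upwards [this] with t ht
    obtain ⟨M, hM⟩ := exists_nat_gt |t|
    refine ht (max N M) (le_max_left _ _) ?_
    have : (M : ℝ) ≤ (max N M : ℕ) := by exact_mod_cast le_max_right _ _
    exact abs_lt.1 (by linarith)

end LineSpeed
end Disentanglement

/-! ### Disentanglement in terms of the speeds along the axes -/

namespace Disentanglement

section Split

open Set Filter Topology

variable {d m : ℕ} {g : EuclideanSpace ℝ (Fin d) → EuclideanSpace ℝ (Fin m)}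
  {p : Fin d → ℝ → ℝ} {I : Fin d → Set ℝ}

/-- The speed along each axis depends, almost everywhere, on the coordinate of that axis only. -/
def SpeedsSplit {d m : ℕ} (g : EuclideanSpace ℝ (Fin d) → EuclideanSpace ℝ (Fin m))
    (p : Fin d → ℝ → ℝ) : Prop :=
  ∀ i, ∃ σ, IsSpeed σ ∧ ∀ᵐ z ∂(prior p), speed g i z = σ (z i)

/-- If the speed splits, so does the arc-length coordinate. The speeds outside the box play no role,
since the base point lies in it and its sides are intervals. -/
theorem ae_coord_eq (h : IsFactorisedPrior p I) {b : EuclideanSpace ℝ (Fin d)} (hb : b ∈ box I)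
    {i : Fin d} {σ : ℝ → ℝ} (hσ : IsSpeed σ) (hs : ∀ᵐ z ∂(prior p), speed g i z = σ (z i)) :
    ∀ᵐ z ∂(prior p), coord g b i z = ∫ t in (b i)..(z i), σ t := by
  have := h.isProbabilityMeasure
  rw [h.prior_eq] at hs ⊢
  refine ae_of_ae_ae_move i ?_ ?_
  · refine measurableSet_eq_fun (measurable_coord b i) ((hσ.continuous (b i)).measurable.comp ?_)
    fun_prop
  filter_upwards [ae_ae_move i hs] with z hz
  rw [h.ae_marginal_iff] at hz ⊢
  refine Eventually.of_forall fun x hx => ?_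
  have hsub : uIcc (b i) x ⊆ I i := (h.ordConnected i).uIcc_subset (hb i) hx
  rw [coord_move, move_apply, if_pos rfl]
  refine intervalIntegral.integral_congr_ae ?_
  filter_upwards [hz] with t ht hmem
  simpa using ht (hsub (uIoc_subset_uIcc hmem))

theorem iIndepFun_coordinates (h : IsFactorisedPrior p I) {X : Fin d → ℝ → ℝ}
    (hX : ∀ i, Measurable (X i)) :
    iIndepFun (fun i (z : EuclideanSpace ℝ (Fin d)) => X i (z i)) (prior p) := by
  have := h.isProbabilityMeasure
  have h1 := iIndepFun_pi (μ := fun i => marginal (p i)) fun i => (hX i).aemeasurable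
  rw [iIndepFun_iff_measure_inter_preimage_eq_mul] at h1 ⊢
  intro S sets hS
  have hm : ∀ i ∈ S, MeasurableSet ((fun z : EuclideanSpace ℝ (Fin d) => X i (z i)) ⁻¹' sets i) :=
    fun i hi => ((hX i).comp (by fun_prop)) (hS i hi)
  rw [h.prior_eq, piLaw, Measure.map_apply measurable_toLp (S.measurableSet_biInter hm)]
  refine Eq.trans ?_ ((h1 S hS).trans (Finset.prod_congr rfl fun i hi => ?_))
  · congr 1
    simp [preimage_iInter]
    rfl
  · rw [Measure.map_apply measurable_toLp (hm i hi)]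
    rfl

/-- If the speeds split, the arc-length coordinates are functions `∫ σ i` of the independent latent
coordinates, and the 1-D densities `f i`, the same on all lines, satisfy `f i (u i) * σ i = p i`;
their product is the manifold density if the volume factor is the product of the speeds. -/
theorem isDisentangled_of_split (h : IsFactorisedPrior p I) (hg : IsCIDAE g)
    (hrank : ∀ᵐ z, Function.Injective (fderiv ℝ g z))
    {ρ : EuclideanSpace ℝ (Fin m) → ℝ≥0∞} (hρ : IsManifoldDensity g p ρ)
    (hvol : ∀ᵐ z ∂(prior p), volumeFactor g z = ∏ i, speed g i z) (hsplit : SpeedsSplit g p) :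
    IsDisentangled g p I ρ := by
  intro b hb
  have hprob := h.isProbabilityMeasure
  choose σ hσ hs using hsplit
  have hcoord := fun i => ae_coord_eq h hb (hσ i) (hs i)
  have hdens : ∀ i, (marginal (p i)).map (fun x => ∫ t in (b i)..x, σ i t) = volume.withDensity
      (((marginal (p i)).map fun x => ∫ t in (b i)..x, σ i t).rnDeriv volume) := fun i =>
    (Measure.withDensity_rnDeriv_eq _ _ ((hσ i).map_marginal_absolutelyContinuous (b i))).symm
  refine ⟨fun i _ => ((marginal (p i)).map fun x => ∫ t in (b i)..x, σ i t).rnDeriv volume,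
    fun i => ?_, fun _ _ _ => rfl, fun i => ?_, ?_, ?_⟩
  · exact (Measure.measurable_rnDeriv _ _).comp measurable_snd
  · have h1 := hcoord i
    rw [h.prior_eq] at h1 ⊢
    filter_upwards [ae_ae_move i h1] with z hz
    rw [← hdens i]
    refine Measure.map_congr ?_
    filter_upwards [hz] with t ht
    simpa using ht
  · have h1 : ∀ᵐ z ∂(prior p), ∀ i, ENNReal.ofReal (σ i (z i)) *
        ((marginal (p i)).map fun x => ∫ t in (b i)..x, σ i t).rnDeriv volume
          (∫ t in (b i)..(z i), σ i t) = ENNReal.ofReal (p i (z i)) :=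
      h.ae_prior_of_ae (ae_all_iff.2 fun i => ae_coordinate ((hσ i).mul_density (b i)
        (h.measurable i) (Measure.measurable_rnDeriv _ _) (hdens i)))
    filter_upwards [h1, ae_all_iff.2 hcoord, ae_all_iff.2 hs, hvol,
      h.ae_prior_of_ae (hρ.volumeFactor_mul hg hrank h.measurable), h.ae_prior_of_ae hrank]
      with z h1 h2 h3 h4 h5 h6
    have h7 : ENNReal.ofReal (volumeFactor g z) ≠ 0 := by simpa using volumeFactor_pos h6
    refine (ENNReal.mul_right_inj h7 ENNReal.ofReal_ne_top).1 ?_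
    rw [h5, ENNReal.ofReal_prod_of_nonneg fun i _ => h.nonneg i _, h4,
      ENNReal.ofReal_prod_of_nonneg fun i _ => speed_nonneg i z, ← Finset.prod_mul_distrib]
    refine Finset.prod_congr rfl fun i _ => ?_
    rw [← h1 i, h2 i, h3 i]
  · refine (iIndepFun_congr fun i => hcoord i).2 ?_
    exact iIndepFun_coordinates h fun i => ((hσ i).continuous (b i)).measurable

/-- The factorisation of the manifold density forces the volume factor to be the product of the
speeds along the axes. -/
theorem IsDisentangled.volumeFactor_eq (h : IsFactorisedPrior p I) (hg : IsCIDAE g)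
    (hrank : ∀ᵐ z, Function.Injective (fderiv ℝ g z))
    (hloc : LocallyIntegrable (fun z => fderiv ℝ g z))
    {ρ : EuclideanSpace ℝ (Fin m) → ℝ≥0∞} (hρ : IsManifoldDensity g p ρ)
    (hdis : IsDisentangled g p I ρ) :
    ∀ᵐ z ∂(prior p), volumeFactor g z = ∏ i, speed g i z := by
  have hprob := h.isProbabilityMeasure
  have hprior : IsProbabilityMeasure (prior p) := by rw [h.prior_eq]; infer_instance
  obtain ⟨b, hb⟩ := h.ae_mem_box.exists
  obtain ⟨f, hfm, hfline, hmap, hprod, -⟩ := hdis b hb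
  have hline : ∀ i, ∀ᵐ z ∂(prior p),
      ENNReal.ofReal (speed g i z) * f i z (coord g b i z) = ENNReal.ofReal (p i (z i)) := by
    intro i
    have h1 := hmap i
    have h2 := h.ae_prior_of_ae (ae_isSpeed hrank hloc)
    rw [h.prior_eq] at h1 h2 ⊢
    refine ae_of_ae_ae_move i ?_ ?_
    · refine measurableSet_eq_fun ((measurable_speed i).ennreal_ofReal.mul
        ((hfm i).comp (measurable_id.prodMk (measurable_coord b i)))) ?_
      exact ((h.measurable i).comp (by fun_prop)).ennreal_ofReal
    · filter_upwards [h1, h2] with z h1 h2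
      simp only [coord_move] at h1
      have h3 := (h2 i).mul_density (b i) (h.measurable i)
        ((hfm i).comp measurable_prodMk_left) h1
      refine h.ae_marginal_of_ae (h3.mono fun t ht => ?_)
      rw [hfline, coord_move, move_apply, if_pos rfl]
      exact ht
  filter_upwards [ae_all_iff.2 hline, hprod,
    h.ae_prior_of_ae (hρ.volumeFactor_mul hg hrank h.measurable), h.ae_prior_of_ae hrank,
    h.ae_prior_of_ae (ae_all_iff.2 fun i => ae_coordinate (i := i) (h.pos_iff i)), h.ae_mem_box]
    with z h1 h2 h3 h4 h5 h6
  have hp : 0 < ∏ i, p i (z i) := Finset.prod_pos fun i _ => (h5 i).2 (h6 i)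
  have hp0 : ENNReal.ofReal (∏ i, p i (z i)) ≠ 0 := by simpa using hp
  have hρ0 : ρ (g z) ≠ 0 := fun h0 => hp0 (by rw [← h3, h0, mul_zero])
  have hρt : ρ (g z) ≠ ⊤ := by
    intro h0
    rw [h0, ENNReal.mul_top (by simpa using volumeFactor_pos h4)] at h3
    exact ENNReal.ofReal_ne_top h3.symm
  have h7 : ENNReal.ofReal (∏ i, speed g i z) * ρ (g z) = ENNReal.ofReal (∏ i, p i (z i)) := by
    rw [h2, ENNReal.ofReal_prod_of_nonneg fun i _ => speed_nonneg i z, ← Finset.prod_mul_distrib,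
      ENNReal.ofReal_prod_of_nonneg fun i _ => h.nonneg i _]
    exact Finset.prod_congr rfl fun i _ => h1 i
  rw [← h3] at h7
  have h8 := (ENNReal.mul_left_inj hρ0 hρt).1 h7
  exact ((ENNReal.ofReal_eq_ofReal_iff (Finset.prod_nonneg fun i _ => speed_nonneg i z)
    (volumeFactor_pos h4).le).1 h8).symm

end Split
end Disentanglement

/-! ### Independent arc lengths have split speeds -/

namespace Disentanglement

section Independence

open Set Filter Topology

variable {d m : ℕ} {g : EuclideanSpace ℝ (Fin d) → EuclideanSpace ℝ (Fin m)}
  {p : Fin d → ℝ → ℝ} {I : Fin d → Set ℝ}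

theorem coord_congr {b b' : EuclideanSpace ℝ (Fin d)} {i : Fin d} (h : b i = b' i) :
    coord g b i = coord g b' i := by
  funext z
  rw [coord_eq, coord_eq, h]

/-- The sign of the arc-length coordinate tells on which side of the base point one is. -/
theorem coord_nonneg_iff {b z : EuclideanSpace ℝ (Fin d)} {i : Fin d}
    (hz : IsSpeed fun t => speed g i (move z i t)) : 0 ≤ coord g b i z ↔ b i ≤ z i := by
  have := (hz.strictMono (b i)).le_iff_le (a := b i) (b := z i)
  simpa [coord_eq] using this

/-- If the speeds along a typical `i`-th line are the speeds everywhere, they serve as the function `σ`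
of the single coordinate `z i`. -/
theorem exists_isSpeed_of_ae_line (h : IsFactorisedPrior p I)
    (hrank : ∀ᵐ z, Function.Injective (fderiv ℝ g z))
    (hloc : LocallyIntegrable (fun z => fderiv ℝ g z)) {i : Fin d}
    (hline : ∀ᵐ w ∂(prior p), ∀ᵐ z ∂(prior p), speed g i z = speed g i (move w i (z i))) :
    ∃ σ, IsSpeed σ ∧ ∀ᵐ z ∂(prior p), speed g i z = σ (z i) := by
  have hprob := h.isProbabilityMeasure
  have hprior : IsProbabilityMeasure (prior p) := by rw [h.prior_eq]; infer_instance
  obtain ⟨w, hw1, hw2⟩ := ((h.ae_prior_of_ae (ae_isSpeed hrank hloc)).and hline).exists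
  exact ⟨_, hw1 i, hw2⟩

/-- An event `{c ≤ z_j}` is, up to null sets, an event of the `j`-th arc-length coordinate for a
suitable base point. -/
theorem exists_coord_event (h : IsFactorisedPrior p I)
    (hrank : ∀ᵐ z, Function.Injective (fderiv ℝ g z))
    (hloc : LocallyIntegrable (fun z => fderiv ℝ g z)) (j : Fin d) (c : ℝ)
    {b : EuclideanSpace ℝ (Fin d)} (hb : b ∈ box I) :
    ∃ β ∈ I j, ∃ T : Set ℝ, MeasurableSet T ∧ ∀ b' : EuclideanSpace ℝ (Fin d), b' j = β →
      ((fun z : EuclideanSpace ℝ (Fin d) => z j) ⁻¹' Ici c : Set _) =ᵐ[prior p]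
        (coord g b' j ⁻¹' T : Set _) := by
  by_cases hc : c ∈ I j
  · refine ⟨c, hc, Ici 0, measurableSet_Ici, fun b' hb' => ?_⟩
    filter_upwards [h.ae_prior_of_ae (ae_isSpeed hrank hloc)] with z hz
    refine propext ?_
    change c ≤ z j ↔ 0 ≤ coord g b' j z
    rw [coord_nonneg_iff (hz j), hb']
  -- The interval `I j` lies on one side of `c`, so that the event is trivial.
  · refine ⟨b j, hb j, {_u | c ≤ b j}, MeasurableSet.const _, fun b' hb' => ?_⟩
    filter_upwards [h.ae_mem_box] with z hz
    refine propext ?_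
    change c ≤ z j ↔ c ≤ b j
    have hoc := (h.ordConnected j).uIcc_subset (hb j) (hz j)
    by_contra hne
    refine hc (hoc ?_)
    rw [mem_uIcc]
    grind

/-- The `i`-th arc-length coordinate and the latent coordinates `z_j`, `j ≠ i`, are mutually
independent. -/
theorem iIndepFun_coord_update (h : IsFactorisedPrior p I)
    (hrank : ∀ᵐ z, Function.Injective (fderiv ℝ g z))
    (hloc : LocallyIntegrable (fun z => fderiv ℝ g z))
    (hind : ∀ b ∈ box I, iIndepFun (fun i z => coord g b i z) (prior p))
    {b : EuclideanSpace ℝ (Fin d)} (hb : b ∈ box I) (i : Fin d) :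
    iIndepFun (fun j (z : EuclideanSpace ℝ (Fin d)) => if j = i then coord g b i z else z j)
      (prior p) := by
  set Y : Fin d → EuclideanSpace ℝ (Fin d) → ℝ :=
    fun j z => if j = i then coord g b i z else z j with hY
  have hYm : ∀ j, Measurable (Y j) := by
    intro j
    by_cases hj : j = i
    · simpa [hY, hj] using measurable_coord b i
    · simp only [hY, hj, if_false]
      fun_prop
  have hev : ∀ j (c : ℝ), ∃ β ∈ I j, ∃ T : Set ℝ, MeasurableSet T ∧
      ∀ b' : EuclideanSpace ℝ (Fin d), b' j = β →
      (Y j ⁻¹' Ici c : Set _) =ᵐ[prior p] (coord g b' j ⁻¹' T : Set _) := by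
    intro j c
    by_cases hj : j = i
    · subst hj
      refine ⟨b j, hb j, Ici c, measurableSet_Ici, fun b' hb' => ?_⟩
      simp only [hY, if_true, coord_congr hb']
      rfl
    · simpa only [hY, hj, if_false] using exists_coord_event h hrank hloc j c hb
  -- It suffices to test half-lines. The `j`-th of them requires a base point with `j`-th coordinate
  -- `β j`, and one base point meets all these requirements.
  rw [iIndepFun_iff_iIndep]
  refine iIndepSets.iIndep (fun j => (hYm j).comap_le)
    (fun j => {S | ∃ T ∈ range (Ici : ℝ → Set ℝ), Y j ⁻¹' T = S}) ?_ ?_ ?_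
  · exact fun j => isPiSystem_Ici.comap (Y j)
  · intro j
    have hgen : (inferInstance : MeasurableSpace ℝ) = .generateFrom (range Ici) :=
      BorelSpace.measurable_eq.trans (borel_eq_generateFrom_Ici ℝ)
    exact (congrArg (MeasurableSpace.comap (Y j)) hgen).trans MeasurableSpace.comap_generateFrom
  · rw [iIndepSets_iff]
    intro S f hf
    have hf' : ∀ j, ∃ c, j ∈ S → Y j ⁻¹' Ici c = f j := by
      intro j
      by_cases hj : j ∈ S
      · obtain ⟨_, ⟨c, rfl⟩, hc⟩ := hf j hj
        exact ⟨c, fun _ => hc⟩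
      · exact ⟨0, fun h => absurd h hj⟩
    choose c hc using hf'
    choose β hβ T hT hβT using fun j => hev j (c j)
    have hae : ∀ j ∈ S, (f j : Set _) =ᵐ[prior p] (coord g (WithLp.toLp 2 β) j ⁻¹' T j : Set _) :=
      fun j hj => hc j hj ▸ hβT j _ rfl
    have hmain := (iIndepFun_iff_measure_inter_preimage_eq_mul.1 (hind (WithLp.toLp 2 β) hβ)) S
      (sets := T) fun j _ => hT j
    rw [measure_congr (S.eventuallyEq_iInter hae),
      Finset.prod_congr rfl fun j hj => measure_congr (hae j hj)]
    exact hmain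

/-- The `i`-th arc-length coordinate is independent of the events that do not depend on `z_i`. -/
theorem measure_coord_inter_eq_mul (h : IsFactorisedPrior p I)
    (hrank : ∀ᵐ z, Function.Injective (fderiv ℝ g z))
    (hloc : LocallyIntegrable (fun z => fderiv ℝ g z))
    (hind : ∀ b ∈ box I, iIndepFun (fun i z => coord g b i z) (prior p))
    {b : EuclideanSpace ℝ (Fin d)} (hb : b ∈ box I) (i : Fin d) {T : Set ℝ}
    (hT : MeasurableSet T) {A : Set (EuclideanSpace ℝ (Fin d))} (hA : MeasurableSet A)
    (hAi : ∀ z t, move z i t ∈ A ↔ z ∈ A) :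
    prior p (coord g b i ⁻¹' T ∩ A) = prior p (coord g b i ⁻¹' T) * prior p A := by
  have hind' := iIndepFun_coord_update h hrank hloc hind hb i
  have hm : ∀ j, Measurable fun z : EuclideanSpace ℝ (Fin d) =>
      if j = i then coord g b i z else z j := by
    intro j
    by_cases hj : j = i
    · simpa [hj] using measurable_coord b i
    · simp only [hj, if_false]
      fun_prop
  have h2 := hind'.indepFun_finset {i} ({i}ᶜ) disjoint_compl_right hm
  rw [indepFun_iff_measure_inter_preimage_eq_mul] at h2
  -- `A` is an event of the coordinates other than the `i`-th.
  let ext : (({i}ᶜ : Finset (Fin d)) → ℝ) → EuclideanSpace ℝ (Fin d) :=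
    fun y => WithLp.toLp 2 fun j => if hj : j ∈ ({i}ᶜ : Finset (Fin d)) then y ⟨j, hj⟩ else 0
  have hext : Measurable ext := by
    refine measurable_toLp.comp (measurable_pi_iff.2 fun j => ?_)
    by_cases hj : j ∈ ({i}ᶜ : Finset (Fin d))
    · simp only [hj, dif_pos]
      exact measurable_pi_apply _
    · simp only [hj, dif_neg, not_false_iff]
      exact measurable_const
  have h3 := h2 ((fun y => y ⟨i, Finset.mem_singleton_self i⟩) ⁻¹' T) (ext ⁻¹' A)
    ((measurable_pi_apply _) hT) (hext hA)
  have e1 : (fun (z : EuclideanSpace ℝ (Fin d)) (j : ({i} : Finset (Fin d))) =>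
      if (j : Fin d) = i then coord g b i z else z j) ⁻¹'
        ((fun y => y ⟨i, Finset.mem_singleton_self i⟩) ⁻¹' T) = coord g b i ⁻¹' T := by
    ext z
    simp
  have e2 : (fun (z : EuclideanSpace ℝ (Fin d)) (j : ({i}ᶜ : Finset (Fin d))) =>
      if (j : Fin d) = i then coord g b i z else z j) ⁻¹' (ext ⁻¹' A) = A := by
    ext z
    have : ext (fun (j : ({i}ᶜ : Finset (Fin d))) =>
        if (j : Fin d) = i then coord g b i z else z j) = move z i 0 := by
      ext j
      by_cases hj : j = i <;> simp [ext, hj]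
    rw [mem_preimage, mem_preimage, this, hAi]
  rwa [e1, e2] at h3

/-- A function whose integral over its own super- and sublevel sets is that of a constant is
constant. -/
theorem ae_eq_const_of_setLIntegral_level {α : Type*} [MeasurableSpace α] {π : Measure α}
    [IsFiniteMeasure π] {H : α → ℝ≥0∞} (hH : Measurable H) {κ : ℝ≥0∞} (hκ : κ ≠ ⊤)
    (h1 : ∫⁻ z in {z | κ < H z}, H z ∂π = κ * π {z | κ < H z})
    (h2 : ∫⁻ z in {z | H z < κ}, H z ∂π = κ * π {z | H z < κ}) : ∀ᵐ z ∂π, H z = κ := by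
  have m1 : MeasurableSet {z | κ < H z} := measurableSet_lt measurable_const hH
  have m2 : MeasurableSet {z | H z < κ} := measurableSet_lt hH measurable_const
  have hfin : ∀ s : Set α, κ * π s ≠ ⊤ := fun s => ENNReal.mul_ne_top hκ (measure_ne_top _ _)
  have a1 := ae_eq_of_ae_le_of_lintegral_le (μ := π.restrict {z | κ < H z}) (f := fun _ => κ)
    (g := H) ((ae_restrict_mem m1).mono fun z hz => le_of_lt hz)
    (by rw [setLIntegral_const]; exact hfin _) hH.aemeasurable
    (by rw [setLIntegral_const, h1])
  have a2 := ae_eq_of_ae_le_of_lintegral_le (μ := π.restrict {z | H z < κ}) (f := H)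
    (g := fun _ => κ) ((ae_restrict_mem m2).mono fun z hz => le_of_lt hz)
    (by rw [h2]; exact hfin _) aemeasurable_const
    (by rw [setLIntegral_const, h2])
  filter_upwards [(ae_restrict_iff' m1).1 a1, (ae_restrict_iff' m2).1 a2] with z b1 b2
  rcases lt_trichotomy κ (H z) with hlt | heq | hgt
  · exact (b1 hlt).symm
  · exact heq.symm
  · exact b2 hgt

/-- The law of the `i`-th arc-length coordinate along almost every axis-aligned line is the law of
that coordinate: the conditional probability `H z`, which does not depend on `z i`, has the same mean
over its own level sets as a constant. -/
theorem ae_marginal_coord_le (h : IsFactorisedPrior p I)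
    (hrank : ∀ᵐ z, Function.Injective (fderiv ℝ g z))
    (hloc : LocallyIntegrable (fun z => fderiv ℝ g z))
    (hind : ∀ b ∈ box I, iIndepFun (fun i z => coord g b i z) (prior p))
    {b : EuclideanSpace ℝ (Fin d)} (hb : b ∈ box I) (i : Fin d) (q : ℝ) :
    ∀ᵐ z ∂(prior p), marginal (p i) {t | coord g b i (move z i t) ≤ q} =
      prior p {z | coord g b i z ≤ q} := by
  have hprob := h.isProbabilityMeasure
  have hprior : IsProbabilityMeasure (prior p) := by rw [h.prior_eq]; infer_instance
  have hE : MeasurableSet (coord g b i ⁻¹' Iic q) := measurable_coord b i measurableSet_Iic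
  have hEm := measurable_move i hE
  set H : EuclideanSpace ℝ (Fin d) → ℝ≥0∞ :=
    fun z => marginal (p i) {t | coord g b i (move z i t) ≤ q} with hH
  have hHm : Measurable H := measurable_measure_prodMk_left hEm
  have hHi : ∀ z t, H (move z i t) = H z := fun z t => by simp only [hH, move_move]
  have key : ∀ A : Set (EuclideanSpace ℝ (Fin d)), MeasurableSet A →
      (∀ z t, move z i t ∈ A ↔ z ∈ A) →
      ∫⁻ z in A, H z ∂(prior p) = prior p (coord g b i ⁻¹' Iic q) * prior p A := by
    intro A hA hAi
    rw [← measure_coord_inter_eq_mul h hrank hloc hind hb i measurableSet_Iic hA hAi, h.prior_eq,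
      ← (measurePreserving_move i).measure_preimage (hE.inter hA).nullMeasurableSet,
      Measure.prod_apply (measurable_move i (hE.inter hA)), ← lintegral_indicator hA]
    congr 1
    funext z
    by_cases hz : z ∈ A
    · rw [indicator_of_mem hz]
      simp only [hH]
      congr 1
      ext t
      simp [hAi, hz]
    · rw [indicator_of_notMem hz]
      symm
      convert measure_empty (μ := marginal (p i))
      ext t
      simp [hAi, hz]
  refine ae_eq_const_of_setLIntegral_level hHm (measure_ne_top _ _) ?_ ?_
  · exact key _ (measurableSet_lt measurable_const hHm) fun z t => by
      simp only [mem_ofPred_eq, hHi]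
  · exact key _ (measurableSet_lt hHm measurable_const) fun z t => by
      simp only [mem_ofPred_eq, hHi]

/-- Increasing maps `F` and `F'` that give the same law to a distribution charging every subinterval
of `J` satisfy `F' ≤ F` on `J`, if `F'` is continuous and strictly increasing: if `F t < r < F' x` for
some `x < t`, then `{F ≤ r}` contains `(-∞, t]` and `{F' ≤ r}` is contained in `(-∞, x]`. -/
theorem le_of_marginal_le {q : ℝ → ℝ} {J : Set ℝ} (hq : IsFiniteMeasure (marginal q))
    (hJ : IsOpen J) (hpos : ∀ᵐ t, 0 < q t ↔ t ∈ J) (hqm : Measurable q) {F F' : ℝ → ℝ}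
    (hF : Monotone F) (hF' : StrictMono F') (hF'c : Continuous F')
    (hlaw : ∀ r : ℚ, marginal q {t | F t ≤ r} = marginal q {t | F' t ≤ r}) {t : ℝ} (ht : t ∈ J) :
    F' t ≤ F t := by
  by_contra! hlt
  have hnear : ∀ᶠ x in 𝓝[<] t, F t < F' x ∧ x ∈ J :=
    ((hF'c.tendsto t).eventually (lt_mem_nhds hlt)).filter_mono nhdsWithin_le_nhds |>.and
      (mem_nhdsWithin_of_mem_nhds (hJ.mem_nhds ht))
  obtain ⟨l, hl, hlJ⟩ : ∃ l < t, Ioo l t ⊆ {x | F t < F' x ∧ x ∈ J} :=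
    (mem_nhdsLT_iff_exists_Ioo_subset).1 hnear
  obtain ⟨x, hlx, hxt⟩ := exists_between hl
  obtain ⟨r, hr1, hr2⟩ := exists_rat_btwn (hlJ ⟨hlx, hxt⟩).1
  have h1 : marginal q (Iic t) ≤ marginal q {τ | F τ ≤ r} :=
    measure_mono fun τ hτ => (hF hτ).trans hr1.le
  have h2 : marginal q {τ | F' τ ≤ r} ≤ marginal q (Iic x) :=
    measure_mono fun τ hτ => (hF'.lt_iff_lt.1 (lt_of_le_of_lt hτ hr2)).le
  have h3 : marginal q (Iic x) + marginal q (Ioo x t) ≤ marginal q (Iic t) := by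
    have hdisj : Disjoint (Iic x) (Ioo x t) :=
      Set.disjoint_left.2 fun a ha ha' => not_lt.2 (show a ≤ x from ha) ha'.1
    rw [← measure_union hdisj measurableSet_Ioo]
    exact measure_mono (union_subset (Iic_subset_Iic.2 hxt.le) fun a ha => ha.2.le)
  have h4 : marginal q (Ioo x t) = 0 := by
    have h5 := h3.trans (h1.trans ((hlaw r).le.trans h2))
    have h6 : marginal q (Iic x) + marginal q (Ioo x t) ≤ marginal q (Iic x) + 0 := by simpa using h5
    simpa using (ENNReal.add_le_add_iff_left (measure_ne_top _ _)).1 h6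
  rw [marginal, withDensity_apply _ measurableSet_Ioo,
    setLIntegral_eq_zero_iff measurableSet_Ioo hqm.ennreal_ofReal] at h4
  have h7 : ∀ᵐ τ, τ ∉ Ioo x t := by
    filter_upwards [h4, hpos] with τ h4 h8 hτ
    have h9 := h8.2 (hlJ ⟨hlx.trans hτ.1, hτ.2⟩).2
    exact absurd (ENNReal.ofReal_eq_zero.1 (h4 hτ)) (not_le.2 h9)
  have h10 := measure_eq_zero_iff_ae_notMem.2 h7
  rw [Real.volume_Ioo, ENNReal.ofReal_eq_zero] at h10
  linarith

/-- If for every base point the arc-length coordinates are independent, the speeds split. -/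
theorem speedsSplit_of_iIndepFun (h : IsFactorisedPrior p I)
    (hrank : ∀ᵐ z, Function.Injective (fderiv ℝ g z))
    (hloc : LocallyIntegrable (fun z => fderiv ℝ g z))
    (hind : ∀ b ∈ box I, iIndepFun (fun i z => coord g b i z) (prior p)) :
    SpeedsSplit g p := by
  intro i
  have hprob := h.isProbabilityMeasure
  have hprior : IsProbabilityMeasure (prior p) := by rw [h.prior_eq]; infer_instance
  obtain ⟨b, hb⟩ := h.ae_mem_box.exists
  refine exists_isSpeed_of_ae_line h hrank hloc ?_
  have hlaw : ∀ᵐ z ∂(prior p), ∀ q : ℚ, marginal (p i) {t | coord g b i (move z i t) ≤ q} =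
      prior p {z | coord g b i z ≤ q} :=
    ae_all_iff.2 fun q => ae_marginal_coord_le h hrank hloc hind hb i q
  have hsp := h.ae_prior_of_ae (ae_isSpeed hrank hloc)
  filter_upwards [hlaw, hsp] with w hw1 hw2
  suffices hlines : ∀ᵐ z ∂(prior p), ∀ᵐ t ∂(marginal (p i)),
      speed g i (move z i t) = speed g i (move w i t) by
    rw [h.prior_eq] at hlines ⊢
    refine ae_of_ae_ae_move i ?_ ?_
    · refine measurableSet_eq_fun (measurable_speed i) ((measurable_speed i).comp ?_)
      exact (measurable_move i).comp (measurable_const.prodMk (by fun_prop))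
    · simpa using hlines
  filter_upwards [hlaw, hsp] with z hz1 hz2
  have heq : ∀ t ∈ I i, coord g b i (move z i t) = coord g b i (move w i t) := by
    intro t ht
    have hzm := (hz2 i).strictMono (b i)
    have hwm := (hw2 i).strictMono (b i)
    have hzc := (hz2 i).continuous (b i)
    have hwc := (hw2 i).continuous (b i)
    simp only [← coord_move] at hzm hwm hzc hwc
    refine le_antisymm ?_ ?_
    · exact le_of_marginal_le inferInstance (h.isOpen i) (h.pos_iff i) (h.measurable i)
        hwm.monotone hzm hzc (fun q => (hw1 q).trans (hz1 q).symm) ht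
    · exact le_of_marginal_le inferInstance (h.isOpen i) (h.pos_iff i) (h.measurable i)
        hzm.monotone hwm hwc (fun q => (hz1 q).trans (hw1 q).symm) ht
  rw [h.ae_marginal_iff]
  filter_upwards [(hz2 i).ae_hasDerivAt (b i), (hw2 i).ae_hasDerivAt (b i)] with t h1 h2 ht
  simp only [← coord_move] at h1 h2
  refine h1.unique (h2.congr_of_eventuallyEq ?_)
  filter_upwards [(h.isOpen i).mem_nhds ht] with x hx using heq x hx

end Independence
end Disentanglement

/-! ### Weak partial derivatives and split functions -/

namespace Disentanglement

section Weak

open Set Filter Topology Convolution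

variable {d : ℕ} {Ω : Set (EuclideanSpace ℝ (Fin d))} {u : EuclideanSpace ℝ (Fin d) → ℝ}

theorem sum_smul_axis (v : EuclideanSpace ℝ (Fin d)) : ∑ j, v j • axis j = v := by
  simpa [axis] using (EuclideanSpace.basisFun (Fin d) ℝ).sum_repr v

/-- A function whose partial derivatives in the directions `j ≠ i` vanish along a segment of a
hyperplane `z i = const` takes the same value at both ends. -/
theorem eq_of_hasFDerivAt_axis_eq_zero {W : EuclideanSpace ℝ (Fin d) → ℝ}
    {W' : EuclideanSpace ℝ (Fin d) → EuclideanSpace ℝ (Fin d) →L[ℝ] ℝ} {i : Fin d}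
    {z z' : EuclideanSpace ℝ (Fin d)} (hzz : z i = z' i)
    (hW : ∀ x ∈ segment ℝ z z', HasFDerivAt W (W' x) x)
    (h0 : ∀ x ∈ segment ℝ z z', ∀ j, j ≠ i → W' x (axis j) = 0) : W z = W z' := by
  have hseg : ∀ t ∈ Icc (0 : ℝ) 1, z + t • (z' - z) ∈ segment ℝ z z' := by
    intro t ht
    rw [segment_eq_image']
    exact ⟨t, ht, rfl⟩
  have hder : ∀ t ∈ Icc (0 : ℝ) 1, HasDerivAt (fun t : ℝ => W (z + t • (z' - z))) 0 t := by
    intro t ht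
    have h1 : HasDerivAt (fun t : ℝ => z + t • (z' - z)) (z' - z) t := by
      simpa using ((hasDerivAt_id t).smul_const (z' - z)).const_add z
    have h2 := (hW _ (hseg t ht)).comp_hasDerivAt t h1
    suffices h3 : W' (z + t • (z' - z)) (z' - z) = 0 by rwa [h3] at h2
    conv_lhs => enter [2]; rw [← sum_smul_axis (z' - z)]
    rw [map_sum]
    refine Finset.sum_eq_zero fun j _ => ?_
    rw [map_smul]
    by_cases hj : j = i
    · subst hj
      simp [hzz]
    · simp [h0 _ (hseg t ht) j hj]
  have h := constant_of_has_deriv_right_zero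
    (fun t ht => (hder t ht).continuousAt.continuousWithinAt)
    (fun t ht => (hder t (Ico_subset_Icc_self ht)).hasDerivWithinAt) 1 (by simp)
  simpa using h.symm

/-- A locally integrable function on a convex open set whose weak partial derivatives in the
directions `j ≠ i` vanish is a function of the `i`-th coordinate, off a null set: its mollifications
are constant along the segments in the hyperplanes `z i = const`. -/
theorem exists_conull_eq_of_weak_partial_eq_zero (hΩ : IsOpen Ω) (hconv : Convex ℝ Ω)
    (hu : LocallyIntegrable u) {i : Fin d}
    (hweak : ∀ j, j ≠ i → ∀ φ : EuclideanSpace ℝ (Fin d) → ℝ, ContDiff ℝ ∞ φ →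
      HasCompactSupport φ → tsupport φ ⊆ Ω → ∫ z, u z * fderiv ℝ φ z (axis j) = 0) :
    ∃ G : Set (EuclideanSpace ℝ (Fin d)), (∀ᵐ z, z ∈ G) ∧
      ∀ z ∈ G ∩ Ω, ∀ z' ∈ G ∩ Ω, z i = z' i → u z = u z' := by
  let φ : ℕ → ContDiffBump (0 : EuclideanSpace ℝ (Fin d)) := fun n =>
    ⟨1 / (n + 1), 2 * (1 / (n + 1)), by positivity, by
      have : (0 : ℝ) < 1 / (n + 1) := by positivity
      linarith⟩
  have hφ : Tendsto (fun n => (φ n).rOut) atTop (𝓝 0) := by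
    change Tendsto (fun n : ℕ => 2 * (1 / ((n : ℝ) + 1))) atTop (𝓝 0)
    simpa using (tendsto_one_div_add_atTop_nhds_zero_nat (𝕜 := ℝ)).const_mul 2
  refine ⟨{x | Tendsto (fun n => ((φ n).normed volume ⋆[ContinuousLinearMap.lsmul ℝ ℝ, volume] u) x)
    atTop (𝓝 (u x))}, ContDiffBump.ae_convolution_tendsto_right_of_locallyIntegrable (K := 2) hφ
      (Eventually.of_forall fun n => le_rfl) hu, fun z hz z' hz' hzz => ?_⟩
  refine tendsto_nhds_unique (hz.1 : Tendsto _ _ _) (Tendsto.congr' ?_ (hz'.1 : Tendsto _ _ _))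
  have hcompact : IsCompact (segment ℝ z z') := by
    rw [segment_eq_image']
    exact isCompact_Icc.image (by fun_prop)
  obtain ⟨δ, hδ, hδΩ⟩ := hcompact.exists_cthickening_subset_open hΩ (hconv.segment_subset hz.2 hz'.2)
  filter_upwards [hφ.eventually (gt_mem_nhds hδ)] with n hn
  set ψ := (φ n).normed volume with hψdef
  have hψ : ContDiff ℝ ∞ ψ := (φ n).contDiff_normed
  have hψc : HasCompactSupport ψ := (φ n).hasCompactSupport_normed
  rw [← convolution_flip]
  set L := (ContinuousLinearMap.lsmul ℝ ℝ : ℝ →L[ℝ] ℝ →L[ℝ] ℝ).flip with hL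
  refine (eq_of_hasFDerivAt_axis_eq_zero hzz
    (fun x _ => hψc.hasFDerivAt_convolution_right L hu (hψ.of_le (by simp)) x)
    fun x hx j hj => ?_).symm
  rw [convolution_precompR_apply L hu (hψc.fderiv ℝ) (hψ.continuous_fderiv (by simp))]
  -- The mollification differentiates to a test of `u` against the reflected bump at `x`.
  have hrefl : ContDiff ℝ ∞ fun t => ψ (x - t) := hψ.comp (contDiff_const.sub contDiff_id)
  have hts : tsupport (fun t => ψ (x - t)) ⊆ Metric.closedBall x (φ n).rOut := by
    refine (tsupport_comp_subset_preimage ψ (f := fun t => x - t) (by fun_prop)).trans fun t ht => ?_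
    rw [mem_preimage, hψdef, ContDiffBump.tsupport_normed_eq] at ht
    simpa [dist_eq_norm, norm_sub_rev] using ht
  have h1 := hweak j hj _ hrefl
    ((isCompact_closedBall x _).of_isClosed_subset (isClosed_tsupport _) hts)
    (hts.trans ((Metric.closedBall_subset_closedBall hn.le).trans
      ((Metric.closedBall_subset_cthickening hx δ).trans hδΩ)))
  have h2 : ∀ t, fderiv ℝ (fun t => ψ (x - t)) t (axis j) = -fderiv ℝ ψ (x - t) (axis j) := by
    intro t
    have h3 : HasFDerivAt (fun t => x - t)
        (-ContinuousLinearMap.id ℝ (EuclideanSpace ℝ (Fin d))) t := by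
      simpa using (hasFDerivAt_id t).const_sub x
    have h4 : HasFDerivAt ψ (fderiv ℝ ψ (x - t)) (x - t) :=
      ((hψ.differentiable (by simp)) _).hasFDerivAt
    have h5 : HasFDerivAt (fun t => ψ (x - t)) _ t := h4.comp t h3
    rw [h5.fderiv]
    simp
  simp only [h2, mul_neg, integral_neg, neg_eq_zero] at h1
  rw [← h1]
  refine integral_congr_ae (Eventually.of_forall fun t => ?_)
  simp [hL, mul_comm]

/-- A function that is almost everywhere on `Ω` a function of the `i`-th coordinate has vanishing
weak partial derivatives in the other directions. -/
theorem hasWeakPartialDeriv_zero_of_ae_eq (hu : LocallyIntegrable u) {i j : Fin d}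
    (hij : i ≠ j) {σ : ℝ → ℝ} (hσ : ∀ᵐ z, z ∈ Ω → u z = σ (z i)) :
    HasWeakPartialDeriv Ω u 0 j := by
  refine ⟨hu.locallyIntegrableOn Ω, locallyIntegrable_zero.locallyIntegrableOn Ω,
    fun φ hφ hφc hφΩ => ?_⟩
  have hoff : ∀ z, z ∉ Ω → φ z = 0 := fun z hz => image_eq_zero_of_notMem_tsupport fun h => hz (hφΩ h)
  have hoff' : ∀ z, z ∉ Ω → fderiv ℝ φ z (axis j) = 0 := fun z hz => by
    rw [image_eq_zero_of_notMem_tsupport fun h => hz (hφΩ (tsupport_fderiv_subset ℝ h))]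
    simp
  have hcont : Continuous fun z => fderiv ℝ φ z (axis j) :=
    (hφ.continuous_fderiv (by simp)).clm_apply continuous_const
  have hcs : HasCompactSupport fun z => fderiv ℝ φ z (axis j) := hφc.fderiv_apply ℝ (axis j)
  have e1 : (fun z => u z * fderiv ℝ φ z (axis j)) =ᵐ[volume]
      fun z => σ (z i) * fderiv ℝ φ z (axis j) := by
    filter_upwards [hσ] with z hz
    by_cases hzΩ : z ∈ Ω
    · rw [hz hzΩ]
    · simp [hoff' z hzΩ]
  have e2 : (fun z => u z * φ z) =ᵐ[volume] fun z => σ (z i) * φ z := by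
    filter_upwards [hσ] with z hz
    by_cases hzΩ : z ∈ Ω
    · rw [hz hzΩ]
    · simp [hoff z hzΩ]
  have i1 := (hu.integrable_smul_right_of_hasCompactSupport hcont hcs).congr e1
  have i2 := (hu.integrable_smul_right_of_hasCompactSupport hφ.continuous hφc).congr e2
  have hline : ∀ z : EuclideanSpace ℝ (Fin d),
      HasLineDerivAt ℝ (fun z : EuclideanSpace ℝ (Fin d) => σ (z i)) 0 z (axis j) := by
    intro z
    have : (fun t : ℝ => σ ((z + t • axis j : EuclideanSpace ℝ (Fin d)) i)) = fun _ => σ (z i) := by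
      funext t
      simp [axis, hij]
    rw [HasLineDerivAt, this]
    exact hasDerivAt_const _ _
  rw [integral_congr_ae e1]
  have key := integral_bilinear_hasLineDerivAt_right_eq_neg_left_of_integrable (μ := volume)
    (B := ContinuousLinearMap.mul ℝ ℝ) (v := axis j)
    (f := fun z : EuclideanSpace ℝ (Fin d) => σ (z i)) (f' := fun _ => 0)
    (g := φ) (g' := fun z => fderiv ℝ φ z (axis j)) (by simp) (by simpa using i1)
    (by simpa using i2) (fun z _ => hline z)
    (fun z _ => ((hφ.differentiable (by simp)) z).hasFDerivAt.hasLineDerivAt (axis j))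
  simpa using key

end Weak
end Disentanglement

/-! ### Split speeds and the vanishing of mixed partial derivatives -/

namespace Disentanglement

section MixedPartials

open Set Filter Topology

variable {d m : ℕ} {g : EuclideanSpace ℝ (Fin d) → EuclideanSpace ℝ (Fin m)}
  {p : Fin d → ℝ → ℝ} {I : Fin d → Set ℝ}

theorem convex_box (hI : ∀ i, (I i).OrdConnected) : Convex ℝ (box I) := by
  intro x hx y hy a b ha hb hab i
  exact (hI i).convex (hx i) (hy i) ha hb hab

/-- If the speed along the `i`-th axis is determined by `z i` on a set of full measure, it is
almost everywhere the speed along any typical line. -/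
theorem exists_isSpeed_of_conull (h : IsFactorisedPrior p I)
    (hrank : ∀ᵐ z, Function.Injective (fderiv ℝ g z))
    (hloc : LocallyIntegrable (fun z => fderiv ℝ g z)) {i : Fin d}
    {G : Set (EuclideanSpace ℝ (Fin d))} (hG : ∀ᵐ z ∂(prior p), z ∈ G)
    (heq : ∀ z ∈ G, ∀ z' ∈ G, z i = z' i → speed g i z = speed g i z') :
    ∃ σ, IsSpeed σ ∧ ∀ᵐ z ∂(prior p), speed g i z = σ (z i) := by
  have hprob := h.isProbabilityMeasure
  refine exists_isSpeed_of_ae_line h hrank hloc ?_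
  rw [h.prior_eq] at hG ⊢
  filter_upwards [ae_ae_move i hG] with w hw
  filter_upwards [hG, (measurePreserving_coordinate i).quasiMeasurePreserving.ae hw] with z hz hz'
  exact heq _ hz _ hz' (by simp)

/-- The singular values are almost everywhere equal to the speeds, and weak derivatives do not see the
difference. -/
theorem speedsSplit_of_c2 (h : IsFactorisedPrior p I)
    (hrank : ∀ᵐ z, Function.Injective (fderiv ℝ g z))
    (hloc : LocallyIntegrable (fun z => fderiv ℝ g z))
    {s : EuclideanSpace ℝ (Fin d) → Fin d → ℝ}
    (hs : ∀ᵐ z ∂(prior p), ∀ i, s z i = speed g i z) (hC2 : C2 I s) : SpeedsSplit g p := by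
  intro i
  obtain ⟨G, hG, heq⟩ := exists_conull_eq_of_weak_partial_eq_zero (isOpen_box h.isOpen)
    (convex_box h.ordConnected) (locallyIntegrable_speed hloc i) (i := i) (fun j hj φ hφ hφc hφI => by
      have h1 := (hC2 i j hj.symm).2.2 φ hφ hφc hφI
      simp only [Pi.zero_apply, zero_mul, integral_zero, neg_zero] at h1
      rw [← h1]
      refine integral_congr_ae ?_
      filter_upwards [h.ae_prior_iff.1 hs] with z hz
      by_cases hzI : z ∈ box I
      · rw [hz hzI]
      · rw [image_eq_zero_of_notMem_tsupport fun h => hzI (hφI (tsupport_fderiv_subset ℝ h))]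
        simp)
  exact exists_isSpeed_of_conull h hrank hloc ((h.ae_prior_of_ae hG).and h.ae_mem_box) heq

theorem SpeedsSplit.C2 (hsplit : SpeedsSplit g p) (h : IsFactorisedPrior p I)
    (hloc : LocallyIntegrable (fun z => fderiv ℝ g z)) : C2 I fun z i => speed g i z := by
  intro i j hij
  obtain ⟨σ, -, hσ⟩ := hsplit i
  exact hasWeakPartialDeriv_zero_of_ae_eq (locallyIntegrable_speed hloc i) hij
    (h.ae_prior_iff.1 hσ)

/-- If the speed along the `i`-th axis is continuous and splits, then it is a function of `z i`
everywhere on the box. -/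
theorem speed_eq_of_continuous (h : IsFactorisedPrior p I) {i : Fin d}
    (hcont : Continuous (speed g i)) {σ : ℝ → ℝ} (hσ : ∀ᵐ z ∂(prior p), speed g i z = σ (z i))
    {x y : EuclideanSpace ℝ (Fin d)} (hx : x ∈ box I) (hy : y ∈ box I) (hxy : x i = y i) :
    speed g i x = speed g i y := by
  -- Compare the speed with its translate by `y - x`, which leaves the `i`-th coordinate unchanged.
  set U : Set (EuclideanSpace ℝ (Fin d)) := box I ∩ (fun w => w + (y - x)) ⁻¹' box I
  have hU : IsOpen U := (isOpen_box h.isOpen).inter ((isOpen_box h.isOpen).preimage (by fun_prop))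
  have hσ1 := h.ae_prior_iff.1 hσ
  have hσ2 : ∀ᵐ w : EuclideanSpace ℝ (Fin d), w + (y - x) ∈ box I →
      speed g i (w + (y - x)) = σ ((w + (y - x)) i) :=
    (measurePreserving_add_right volume (y - x)).quasiMeasurePreserving.ae hσ1
  have hae : speed g i =ᵐ[volume.restrict U] fun w => speed g i (w + (y - x)) := by
    refine (ae_restrict_iff' hU.measurableSet).2 ?_
    filter_upwards [hσ1, hσ2] with w h1 h2 hw
    rw [h1 hw.1, h2 hw.2]
    simp [hxy]
  have := Measure.eqOn_open_of_ae_eq hae hU hcont.continuousOn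
    (hcont.comp (continuous_id.add continuous_const)).continuousOn
    (show x ∈ U from ⟨hx, by simpa using hy⟩)
  simpa using this

theorem SpeedsSplit.C2Classical (hsplit : SpeedsSplit g p) (h : IsFactorisedPrior p I)
    (hg2 : ContDiff ℝ 2 g) : C2Classical p fun z i => speed g i z := by
  filter_upwards [h.ae_mem_box] with z hz i j hij
  obtain ⟨σ, -, hσ⟩ := hsplit i
  have hcont : Continuous (speed g i) :=
    ((hg2.continuous_fderiv (by norm_num)).clm_apply continuous_const).norm
  have hev : (fun t : ℝ => speed g i (z + t • axis j)) =ᶠ[𝓝 0] fun _ => speed g i z := by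
    have hc : Continuous fun t : ℝ => z + t • axis j := by fun_prop
    have : ∀ᶠ t : ℝ in 𝓝 0, z + t • axis j ∈ box I :=
      hc.continuousAt.eventually_mem ((isOpen_box h.isOpen).mem_nhds (by simpa using hz))
    filter_upwards [this] with t ht
    exact speed_eq_of_continuous h hcont hσ ht hz (by simp [axis, hij])
  exact (hasDerivAt_const (0 : ℝ) (speed g i z)).congr_of_eventuallyEq hev

/-- Two functions on the line that agree almost everywhere near a point, and at that point, have
there the same derivative. -/
theorem eq_of_hasDerivAt_of_ae_eq {q r : ℝ → ℝ} {q' r' x : ℝ} {N : Set ℝ} (hN : N ∈ 𝓝 x)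
    (hq : HasDerivAt q q' x) (hr : HasDerivAt r r' x) (hx : q x = r x)
    (hae : ∀ᵐ t, t ∈ N → q t = r t) : q' = r' := by
  have hacc : AccPt x (𝓟 {t | q t = r t}) := by
    rw [accPt_iff_frequently]
    intro hev
    have h1 : ∀ᵐ t, t ∉ {t | ¬(t ≠ x ∧ t ∈ {t | q t = r t})} ∩ N := by
      filter_upwards [hae, (measure_eq_zero_iff_ae_notMem.1 (Real.volume_singleton (a := x)))]
        with t h1 h2 h3
      exact h3.1 ⟨h2, h1 h3.2⟩
    exact (Measure.measure_pos_of_mem_nhds volume (inter_mem hev hN)).ne'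
      (measure_eq_zero_iff_ae_notMem.2 h1)
  have hu : UniqueDiffWithinAt ℝ {t | q t = r t} x := uniqueDiffWithinAt_iff_accPt.2 hacc
  exact hu.eq_deriv _ hq.hasDerivWithinAt
    (hr.hasDerivWithinAt.congr (fun t ht => ht) hx)

/-- The singular values are only almost everywhere equal to the speeds, but on almost every
axis-aligned line they are so almost everywhere, hence on a set accumulating at almost every point of
the line, which is enough to compare derivatives. -/
theorem speedsSplit_of_c2Classical (h : IsFactorisedPrior p I)
    (hrank : ∀ᵐ z, Function.Injective (fderiv ℝ g z))
    (hloc : LocallyIntegrable (fun z => fderiv ℝ g z)) (hg2 : ContDiff ℝ 2 g)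
    {s : EuclideanSpace ℝ (Fin d) → Fin d → ℝ}
    (hs : ∀ᵐ z ∂(prior p), ∀ i, s z i = speed g i z) (hC2 : C2Classical p s) :
    SpeedsSplit g p := by
  intro i
  have hprob := h.isProbabilityMeasure
  -- The squared speed is continuously differentiable, also at zeros of the speed.
  set Q : EuclideanSpace ℝ (Fin d) → ℝ := fun z => speed g i z ^ 2 with hQdef
  have hQ : ContDiff ℝ 1 Q :=
    ((hg2.fderiv_right (m := 1) (by norm_num)).clm_apply contDiff_const).norm_sq ℝ
  have hQd : ∀ z, HasFDerivAt Q (fderiv ℝ Q z) z := fun z =>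
    ((hQ.differentiable (by norm_num)) z).hasFDerivAt
  have hbox := isOpen_box h.isOpen
  have hzero : ∀ j, j ≠ i → ∀ z ∈ box I, fderiv ℝ Q z (axis j) = 0 := by
    intro j hj
    have hcont : Continuous fun z => fderiv ℝ Q z (axis j) :=
      (hQ.continuous_fderiv one_ne_zero).clm_apply continuous_const
    suffices hae : ∀ᵐ z ∂(prior p), fderiv ℝ Q z (axis j) = 0 from
      fun z hz => Measure.eqOn_open_of_ae_eq
        ((ae_restrict_iff' hbox.measurableSet).2 (h.ae_prior_iff.1 hae)) hbox hcont.continuousOn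
        (continuousOn_const (c := (0 : ℝ))) hz
    have hlines : ∀ᵐ z ∂(prior p), ∀ᵐ t ∂(marginal (p j)), ∀ k, s (move z j t) k =
        speed g k (move z j t) := by
      rw [h.prior_eq] at hs ⊢
      exact ae_ae_move (P := fun z => ∀ k, s z k = speed g k z) j hs
    filter_upwards [hs, hC2, hlines, h.ae_mem_box] with z h1 h2 h3 h4
    have h5 : ∀ᵐ τ : ℝ, z j + τ ∈ I j → s (z + τ • axis j) i = speed g i (z + τ • axis j) := by
      filter_upwards [(measurePreserving_add_left volume (z j)).quasiMeasurePreserving.ae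
        (h.ae_marginal_iff.1 h3)] with τ h6 h7
      have h8 := h6 h7 i
      rwa [move_eq_add_smul, add_sub_cancel_left] at h8
    have hr : HasDerivAt (fun τ : ℝ => s (z + τ • axis j) i ^ 2) 0 0 := by
      have h6 : HasDerivAt (fun τ : ℝ => s (z + τ • axis j) i) 0 0 := h2 i j hj.symm
      have h7 : HasDerivAt (fun τ : ℝ => s (z + τ • axis j) i ^ 2) _ 0 := h6.pow 2
      simpa using h7
    have hN : (fun τ => z j + τ) ⁻¹' I j ∈ 𝓝 (0 : ℝ) :=
      ((h.isOpen j).preimage (by fun_prop)).mem_nhds (by simpa using h4 j)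
    refine eq_of_hasDerivAt_of_ae_eq hN ((hQd z).hasLineDerivAt (axis j)) hr
      (by simp [hQdef, h1 i]) ?_
    filter_upwards [h5] with τ h5 h6
    rw [h5 h6]
  refine exists_isSpeed_of_conull h hrank hloc h.ae_mem_box fun z hz z' hz' hzz => ?_
  have hseg := (convex_box h.ordConnected).segment_subset hz hz'
  have hQeq : Q z = Q z' := eq_of_hasFDerivAt_axis_eq_zero hzz (fun x _ => hQd x)
    fun x hx j hj => hzero j hj x (hseg hx)
  exact (sq_eq_sq₀ (speed_nonneg i z) (speed_nonneg i z')).1 hQeq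

end MixedPartials
end Disentanglement

/-! ### Disentanglement and the constraints -/

namespace Disentanglement

variable {d m : ℕ} {g : EuclideanSpace ℝ (Fin d) → EuclideanSpace ℝ (Fin m)}
  {p : Fin d → ℝ → ℝ} {I : Fin d → Set ℝ}

theorem IsDisentangled.C1 (h : IsFactorisedPrior p I) (hg : IsCIDAE g)
    (hrank : ∀ᵐ z, Function.Injective (fderiv ℝ g z))
    (hloc : LocallyIntegrable (fun z => fderiv ℝ g z))
    {ρ : EuclideanSpace ℝ (Fin m) → ℝ≥0∞} (hρ : IsManifoldDensity g p ρ)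
    (hdis : IsDisentangled g p I ρ) : C1 g p fun z i => speed g i z := by
  filter_upwards [hdis.volumeFactor_eq h hg hrank hloc hρ, h.ae_prior_of_ae hrank] with z hz hinj
  exact exists_isSVD_speed hinj ((volumeFactor_eq_prod_iff hinj).1 hz)

theorem C1.eq_speed {s : EuclideanSpace ℝ (Fin d) → Fin d → ℝ} (hC1 : C1 g p s) :
    ∀ᵐ z ∂(prior p), ∀ i, s z i = speed g i z :=
  hC1.mono fun _ ⟨_, hU⟩ => hU.eq_speed.1

theorem isDisentangled_of_c1_of_split (h : IsFactorisedPrior p I) (hg : IsCIDAE g)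
    (hrank : ∀ᵐ z, Function.Injective (fderiv ℝ g z))
    {ρ : EuclideanSpace ℝ (Fin m) → ℝ≥0∞} (hρ : IsManifoldDensity g p ρ)
    {s : EuclideanSpace ℝ (Fin d) → Fin d → ℝ} (hC1 : C1 g p s) (hsplit : SpeedsSplit g p) :
    IsDisentangled g p I ρ := by
  refine isDisentangled_of_split h hg hrank hρ ?_ hsplit
  filter_upwards [hC1, h.ae_prior_of_ae hrank] with z ⟨U, hU⟩ hinj
  exact (volumeFactor_eq_prod_iff hinj).2 hU.eq_speed.2

theorem IsDisentangled.speedsSplit (h : IsFactorisedPrior p I)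
    (hrank : ∀ᵐ z, Function.Injective (fderiv ℝ g z))
    (hloc : LocallyIntegrable (fun z => fderiv ℝ g z))
    {ρ : EuclideanSpace ℝ (Fin m) → ℝ≥0∞} (hdis : IsDisentangled g p I ρ) : SpeedsSplit g p :=
  speedsSplit_of_iIndepFun h hrank hloc fun b hb => by
    obtain ⟨f, -, -, -, -, hf⟩ := hdis b hb
    exact hf

end Disentanglement

theorem mainTheorem1 {d m : ℕ}
    (g : EuclideanSpace ℝ (Fin d) → EuclideanSpace ℝ (Fin m))
    (hg : Disentanglement.IsCIDAE g)
    (hg_rank : ∀ᵐ z, Function.Injective (fderiv ℝ g z))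
    (hg_loc : LocallyIntegrable (fun z => fderiv ℝ g z))
    (p : Fin d → ℝ → ℝ)
    (hp_meas : ∀ i, Measurable (p i))
    (hp_nonneg : ∀ i t, 0 ≤ p i t)
    (hp_one : ∀ i, ∫⁻ t, ENNReal.ofReal (p i t) = 1)
    (I : Fin d → Set ℝ)
    (hI_open : ∀ i, IsOpen (I i))
    (hI_conn : ∀ i, (I i).OrdConnected)
    (hp_pos : ∀ i, ∀ᵐ t, 0 < p i t ↔ t ∈ I i) :
    (∃ ρ, Disentanglement.IsManifoldDensity g p ρ) ∧
    ∀ ρ, Disentanglement.IsManifoldDensity g p ρ →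
      (Disentanglement.IsDisentangled g p I ρ ↔
        ∃ s, Disentanglement.C1 g p s ∧ Disentanglement.C2 I s) ∧
      (ContDiff ℝ 2 g →
        (Disentanglement.IsDisentangled g p I ρ ↔
          ∃ s, Disentanglement.C1 g p s ∧ Disentanglement.C2Classical p s)) := by
  have h : Disentanglement.IsFactorisedPrior p I :=
    ⟨hp_meas, hp_nonneg, hp_one, hI_open, hI_conn, hp_pos⟩
  refine ⟨Disentanglement.exists_isManifoldDensity hg hg_rank hp_meas, fun ρ hρ => ⟨⟨?_, ?_⟩,
    fun hg2 => ⟨?_, ?_⟩⟩⟩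
  · intro hdis
    exact ⟨_, hdis.C1 h hg hg_rank hg_loc hρ, (hdis.speedsSplit h hg_rank hg_loc).C2 h hg_loc⟩
  · rintro ⟨s, hC1, hC2⟩
    exact Disentanglement.isDisentangled_of_c1_of_split h hg hg_rank hρ hC1
      (Disentanglement.speedsSplit_of_c2 h hg_rank hg_loc hC1.eq_speed hC2)
  · intro hdis
    exact ⟨_, hdis.C1 h hg hg_rank hg_loc hρ,
      (hdis.speedsSplit h hg_rank hg_loc).C2Classical h hg2⟩
  · rintro ⟨s, hC1, hC2⟩
    exact Disentanglement.isDisentangled_of_c1_of_split h hg hg_rank hρ hC1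
      (Disentanglement.speedsSplit_of_c2Classical h hg_rank hg_loc hg2 hC1.eq_speed hC2)
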